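/- **Lemma 4.1.** Let $j\ge 1$ be an integer and let $p,q\in[1,\infty]$ satisfy $$\frac{1}{2j+1}=\frac{2}{q}+\frac{2}{(2j+1)p},\qquad p\ge 2$$ (with $1/\infty=0$). Let $p',q'\in[1,\infty]$ be the dual exponents, $\frac1p+\frac1{p'}=1$ and $\frac1q+\frac1{q'}=1$. Then there is a finite constant $c\ge 0$, depending only on $j,p,q$, such that for every $\lambda\in\mathbb{R}$ and every complex-valued $f=f(x,t)\in C_0^\infty(\mathbb{R}^2)$ (smooth with compact support) $$\|e^{\lambda x}f\|_{L_t^qL_x^p}\le c\,\|e^{\lambda x}(\partial_t+\partial_x^{2j+1})f\|_{L_t^{q'}L_x^{p'}}.$$ Here $\|F\|_{L^q_tL^p_x}$ is the $L^q(\mathbb{R})$ norm of the function $t\mapsto\|F(\cdot,t)\|_{L^p(\mathbb{R})}$. -/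

import Mathlib

open MeasureTheory
open scoped ENNReal NNReal ContDiff

/-- The mixed norm `‖F‖_{L^q_t L^p_x}` on `ℝ²` (Lebesgue measure in each variable), with values in
`[0, ∞]`: the `L^q` norm in `t` of the function `t ↦ ‖F(·, t)‖_{L^p_x}`. A point of the plane is
written `(x, t)`; the exponents may be infinite, in which case essential suprema are taken. -/
noncomputable def mixedNorm (q p : ℝ≥0∞) (F : ℝ × ℝ → ℂ) : ℝ≥0∞ :=
  eLpNorm (fun t : ℝ => eLpNorm (fun x : ℝ => F (x, t)) p volume) q volume

/-- The operator `∂_t + ∂_x^n` applied to `f = f(x, t)`. -/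
noncomputable def dispersiveOp (n : ℕ) (f : ℝ × ℝ → ℂ) : ℝ × ℝ → ℂ :=
  fun z => deriv (fun t : ℝ => f (z.1, t)) z.2 + iteratedDeriv n (fun x : ℝ => f (x, z.2)) z.1

/-- Multiplication by the weight `e^{l x}`: the function `(x, t) ↦ e^{l x} F(x, t)`. -/
noncomputable def expWeight (l : ℝ) (F : ℝ × ℝ → ℂ) : ℝ × ℝ → ℂ :=
  fun z => (Real.exp (l * z.1) : ℂ) * F z

open Set
open scoped FourierTransform

/-! Put n = 2j+1. Conjugation by e^{lx} replaces ∂_x by ∂_x - l, so in frequency the equation for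
e^{lx}f is the scalar equation y' + w^n y = H with w = 2πiξ - l. The sign of Re w^n varies with ξ,
so neither time direction is stable for all frequencies. Since f has compact support in time, each
frequency may be solved in its own stable direction: forwards where Re w^n ≥ 0, backwards where Re
w^n < 0. The resulting multiplier at time difference τ is bounded by 1, so by Plancherel it
contracts L².

The point is an L¹ → L^∞ bound by a multiple of |τ|^{-1/n}, uniform in l
(`norm_fourierInv_propagatorSymbol_le`). The kernel is an oscillatory integral of e^Φ with Φ = 2πixξ
- τw^n, and Φ' is a polynomial of degree n-1 whose leading coefficient does not involve l. With r =
|τ|^{-1/n}, the points within r of the real part of a root contribute O(r) trivially. Away from them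
|Φ'| is at least a constant times |τ| r^{n-1} = r^{-1}, and one integration by parts again gives
O(r). The number of intervals, including those cut by sign changes of Re w^n, depends only on n.

Interpolating with L² gives L^{p'} → L^p with factor |τ|^{-(1-2/p)/n}, and the relation between p
and q says that this exponent is 2/q. Minkowski's inequality in Duhamel's formula then leaves a
convolution in time with |τ|^{-2/q}: Hardy–Littlewood–Sobolev if q is finite, trivial if q = ∞.
Frequencies are truncated to [-R, R] to keep every integral absolutely convergent; all bounds are
uniform in R, and R → ∞ at the end. Interpolation and Hardy–Littlewood–Sobolev are both obtained by
the level-set argument of `lintegral_rpow_le_of_meas_lt_le`. -/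

/-! ### Oscillatory integrals away from the roots of the phase derivative -/

/-- The primitive -(ξ-b)⁻¹ has constant sign on one side of b, so only the endpoint nearer to b
counts and the length of the interval is irrelevant. -/
theorem integral_inv_sq_sub_le {u v b r : ℝ} (huv : u ≤ v) (hr : 0 < r)
    (h : v ≤ b - r ∨ b + r ≤ u) :
    IntervalIntegrable (fun ξ : ℝ => ((ξ - b) ^ 2)⁻¹) volume u v ∧
      ∫ ξ in u..v, ((ξ - b) ^ 2)⁻¹ ≤ r⁻¹ := by
  have hne : ∀ ξ ∈ uIcc u v, ξ - b ≠ 0 := by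
    intro ξ hξ
    rw [uIcc_of_le huv] at hξ
    rcases h with h | h
    · have := hξ.2; intro h0; linarith
    · have := hξ.1; intro h0; linarith
  have hd : ∀ ξ ∈ uIcc u v, HasDerivAt (fun ξ : ℝ => -(ξ - b)⁻¹) (((ξ - b) ^ 2)⁻¹) ξ := by
    intro ξ hξ
    have := (((hasDerivAt_id' ξ).sub_const b).fun_inv (hne ξ hξ)).fun_neg
    rwa [neg_div, neg_neg, one_div] at this
  have hi : IntervalIntegrable (fun ξ : ℝ => ((ξ - b) ^ 2)⁻¹) volume u v := by
    apply ContinuousOn.intervalIntegrable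
    apply ContinuousOn.inv₀ (by fun_prop)
    intro ξ hξ
    exact pow_ne_zero 2 (hne ξ hξ)
  refine ⟨hi, ?_⟩
  rw [intervalIntegral.integral_eq_sub_of_hasDerivAt hd hi]
  rcases h with h | h
  · have h1 : (b - v)⁻¹ ≤ r⁻¹ := inv_anti₀ hr (by linarith)
    have h2 : 0 ≤ (b - u)⁻¹ := inv_nonneg.2 (by linarith)
    rw [← neg_sub b v, ← neg_sub b u, inv_neg, inv_neg]
    linarith
  · have h1 : (u - b)⁻¹ ≤ r⁻¹ := inv_anti₀ hr (by linarith)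
    have h2 : 0 ≤ (v - b)⁻¹ := inv_nonneg.2 (by linarith)
    linarith

/-- A first-derivative oscillatory integral bound, for a complex phase whose derivative is a
polynomial with all roots at horizontal distance at least `r` from the interval. -/
theorem norm_integral_cexp_le_of_roots_far {m : ℕ} {c : ℂ} (hc : c ≠ 0) (z : Fin m → ℂ)
    {Φ : ℝ → ℂ} (hΦ : ∀ ξ : ℝ, HasDerivAt Φ (c * ∏ i, ((ξ : ℂ) - z i)) ξ)
    {u v r : ℝ} (huv : u ≤ v) (hr : 0 < r) (hre : ∀ ξ ∈ Icc u v, (Φ ξ).re ≤ 0)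
    (hz : ∀ i, v ≤ (z i).re - r ∨ (z i).re + r ≤ u) :
    ‖∫ ξ in u..v, Complex.exp (Φ ξ)‖ ≤ (m + 2) / (‖c‖ * r ^ m) := by
  have hfar : ∀ i, ∀ ξ ∈ Icc u v, r ≤ |ξ - (z i).re| := by
    intro i ξ hξ
    rcases hz i with h | h
    · rw [abs_sub_comm]; exact le_trans (by linarith [hξ.2]) (le_abs_self _)
    · exact le_trans (by linarith [hξ.1]) (le_abs_self _)
  have hnorm : ∀ i (ξ : ℝ), |ξ - (z i).re| ≤ ‖(ξ : ℂ) - z i‖ := by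
    intro i ξ
    simpa using Complex.abs_re_le_norm ((ξ : ℂ) - z i)
  have hne : ∀ i, ∀ ξ ∈ Icc u v, (ξ : ℂ) - z i ≠ 0 := by
    intro i ξ hξ h0
    have := (hfar i ξ hξ).trans (hnorm i ξ)
    rw [h0, norm_zero] at this
    linarith
  have hc0 : 0 < ‖c‖ := norm_pos_iff.2 hc
  have hle1 : ∀ ξ ∈ Icc u v, ‖Complex.exp (Φ ξ)‖ ≤ 1 := by
    intro ξ hξ
    rw [Complex.norm_exp]
    exact Real.exp_le_one_iff.2 (hre ξ hξ)
  have hinv : ∀ i, ∀ ξ ∈ Icc u v, ‖((ξ : ℂ) - z i)⁻¹‖ ≤ r⁻¹ := by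
    intro i ξ hξ
    rw [norm_inv]
    exact inv_anti₀ hr ((hfar i ξ hξ).trans (hnorm i ξ))
  -- G = 1/Φ', so that e^Φ = G (e^Φ)' and integration by parts applies.
  set G : ℝ → ℂ := fun ξ => c⁻¹ * ∏ i, ((ξ : ℂ) - z i)⁻¹ with hG
  set G' : ℝ → ℂ := fun ξ => c⁻¹ * ∑ i, (∏ k ∈ Finset.univ.erase i, ((ξ : ℂ) - z k)⁻¹) *
    (-1 / ((ξ : ℂ) - z i) ^ 2) with hG'
  have hGd : ∀ ξ ∈ uIcc u v, HasDerivAt G (G' ξ) ξ := by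
    intro ξ hξ
    rw [uIcc_of_le huv] at hξ
    have := HasDerivAt.fun_finsetProd (u := Finset.univ)
      (f := fun i (ξ : ℝ) => ((ξ : ℂ) - z i)⁻¹)
      (f' := fun i => -1 / ((ξ : ℂ) - z i) ^ 2) (x := ξ) (fun i _ => by
        exact (((hasDerivAt_id ξ).ofReal_comp).sub_const (z i)).fun_inv (hne i ξ hξ))
    simpa [hG, hG', smul_eq_mul] using this.const_mul c⁻¹
  have hcont : ∀ i, ContinuousOn (fun ξ : ℝ => ((ξ : ℂ) - z i)⁻¹) (uIcc u v) := by
    intro i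
    rw [uIcc_of_le huv]
    exact ContinuousOn.inv₀ (by fun_prop) (hne i)
  have hΦc : Continuous Φ := continuous_iff_continuousAt.2 fun ξ => (hΦ ξ).continuousAt
  have hG'c : ContinuousOn G' (uIcc u v) := by
    apply ContinuousOn.mul continuousOn_const
    apply continuousOn_finsetSum
    intro i _
    apply ContinuousOn.mul
    · exact continuousOn_finsetProd _ fun k _ => hcont k
    · apply ContinuousOn.div continuousOn_const (by fun_prop)
      intro ξ hξ
      rw [uIcc_of_le huv] at hξ
      exact pow_ne_zero 2 (hne i ξ hξ)
  have hEd : ∀ ξ ∈ uIcc u v, HasDerivAt (fun ξ => Complex.exp (Φ ξ))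
      (Complex.exp (Φ ξ) * (c * ∏ i, ((ξ : ℂ) - z i))) ξ := fun ξ _ => (hΦ ξ).cexp
  have hparts := intervalIntegral.integral_mul_deriv_eq_deriv_mul hGd hEd
    hG'c.intervalIntegrable (by apply Continuous.intervalIntegrable; fun_prop)
  have hlhs : ∫ ξ in u..v, G ξ * (Complex.exp (Φ ξ) * (c * ∏ i, ((ξ : ℂ) - z i)))
      = ∫ ξ in u..v, Complex.exp (Φ ξ) := by
    apply intervalIntegral.integral_congr
    intro ξ hξ
    rw [uIcc_of_le huv] at hξ
    have : (∏ i, ((ξ : ℂ) - z i)) ≠ 0 := Finset.prod_ne_zero_iff.2 fun i _ => hne i ξ hξ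
    simp only [hG, Finset.prod_inv_distrib]
    field_simp
  rw [← hlhs, hparts]
  have hGle : ∀ ξ ∈ Icc u v, ‖G ξ‖ ≤ (‖c‖ * r ^ m)⁻¹ := by
    intro ξ hξ
    simp only [hG, norm_mul, norm_prod, norm_inv c]
    rw [mul_inv]
    gcongr
    calc ∏ i, ‖((ξ : ℂ) - z i)⁻¹‖ ≤ ∏ i : Fin m, r⁻¹ :=
          Finset.prod_le_prod (fun _ _ => norm_nonneg _) fun i _ => hinv i ξ hξ
      _ = (r ^ m)⁻¹ := by simp
  have hb : ∀ w ∈ Icc u v, ‖G w * Complex.exp (Φ w)‖ ≤ (‖c‖ * r ^ m)⁻¹ := by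
    intro w hw
    rw [norm_mul]
    calc _ ≤ (‖c‖ * r ^ m)⁻¹ * 1 := by gcongr; exacts [hGle w hw, hle1 w hw]
      _ = _ := mul_one _
  have hint : ‖∫ ξ in u..v, G' ξ * Complex.exp (Φ ξ)‖ ≤ m * (‖c‖ * r ^ m)⁻¹ := by
    -- In each term of G' the squared factor is kept and the other m-1 are bounded by r⁻¹.
    -- Integrating the square then costs only one more r⁻¹. The m terms together with the two
    -- boundary values give the constant m + 2.
    have hbound : ∀ ξ ∈ Icc u v, ‖G' ξ * Complex.exp (Φ ξ)‖ ≤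
        ∑ i, (‖c‖⁻¹ * (r ^ (m - 1))⁻¹) * ((ξ - (z i).re) ^ 2)⁻¹ := by
      intro ξ hξ
      rw [norm_mul]
      calc ‖G' ξ‖ * ‖Complex.exp (Φ ξ)‖ ≤ ‖G' ξ‖ * 1 := by gcongr; exact hle1 ξ hξ
        _ ≤ _ := by
          rw [mul_one]
          simp only [hG', norm_mul, norm_inv c]
          rw [← Finset.mul_sum, mul_assoc, Finset.mul_sum]
          gcongr
          refine (norm_sum_le _ _).trans (Finset.sum_le_sum fun i _ => ?_)
          rw [norm_mul, norm_prod]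
          gcongr
          · calc ∏ k ∈ Finset.univ.erase i, ‖((ξ : ℂ) - z k)⁻¹‖
                ≤ ∏ k ∈ Finset.univ.erase i, r⁻¹ :=
                  Finset.prod_le_prod (fun _ _ => norm_nonneg _) fun k _ => hinv k ξ hξ
              _ = (r ^ (m - 1))⁻¹ := by
                  rw [Finset.prod_const, Finset.card_erase_of_mem (Finset.mem_univ _)]; simp
          · rw [norm_div, norm_neg, norm_one, norm_pow, one_div]
            apply inv_anti₀
            · have := hfar i ξ hξ
              rw [← sq_abs]; have : 0 < |ξ - (z i).re| := by linarith
              positivity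
            · rw [← sq_abs]
              gcongr
              exact hnorm i ξ
    have hI := fun i => integral_inv_sq_sub_le huv hr (hz i)
    calc ‖∫ ξ in u..v, G' ξ * Complex.exp (Φ ξ)‖
        ≤ ∫ ξ in u..v, ∑ i, (‖c‖⁻¹ * (r ^ (m - 1))⁻¹) * ((ξ - (z i).re) ^ 2)⁻¹ := by
          apply intervalIntegral.norm_integral_le_of_norm_le huv
          · exact Filter.Eventually.of_forall fun ξ hξ => hbound ξ ⟨hξ.1.le, hξ.2⟩
          · have := IntervalIntegrable.sum Finset.univ (μ := volume) (a := u) (b := v)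
              (f := fun i (ξ : ℝ) => (‖c‖⁻¹ * (r ^ (m - 1))⁻¹) * ((ξ - (z i).re) ^ 2)⁻¹)
              fun i _ => (hI i).1.const_mul _
            simpa only [Finset.sum_fn] using this
      _ = ∑ i, (‖c‖⁻¹ * (r ^ (m - 1))⁻¹) * ∫ ξ in u..v, ((ξ - (z i).re) ^ 2)⁻¹ := by
          rw [intervalIntegral.integral_finsetSum]
          · simp
          · intro i _
            exact (hI i).1.const_mul _
      _ ≤ ∑ i : Fin m, (‖c‖⁻¹ * (r ^ (m - 1))⁻¹) * r⁻¹ := by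
          gcongr with i
          exact (hI i).2
      _ = m * (‖c‖ * r ^ m)⁻¹ := by
          -- For m = 0 the exponent m - 1 is truncated, but the sum is empty.
          rcases Nat.eq_zero_or_pos m with h0 | h0
          · subst h0; simp
          · obtain ⟨k, rfl⟩ := Nat.exists_eq_succ_of_ne_zero h0.ne'
            simp only [Finset.sum_const, Finset.card_univ, Fintype.card_fin, nsmul_eq_mul, pow_succ,
              Nat.succ_eq_add_one, Nat.add_sub_cancel, mul_inv]
            ring
  calc _ ≤ ‖G v * Complex.exp (Φ v)‖ + ‖G u * Complex.exp (Φ u)‖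
        + ‖∫ ξ in u..v, G' ξ * Complex.exp (Φ ξ)‖ :=
        (norm_sub_le _ _).trans (by gcongr; exact norm_sub_le _ _)
    _ ≤ (‖c‖ * r ^ m)⁻¹ + (‖c‖ * r ^ m)⁻¹ + m * (‖c‖ * r ^ m)⁻¹ := by
        gcongr
        · exact hb v ⟨huv, le_rfl⟩
        · exact hb u ⟨le_rfl, huv⟩
    _ = _ := by rw [div_eq_mul_inv]; ring

/-- Splitting an integral at finitely many points. -/
theorem norm_integral_le_of_breakpoints {f : ℝ → ℂ} (hf : ∀ u v, IntervalIntegrable f volume u v)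
    (B : Finset ℝ) {M : ℝ}
    (h : ∀ u v, u ≤ v → (∀ b ∈ B, b ∉ Ioo u v) → ‖∫ ξ in u..v, f ξ‖ ≤ M) {u v : ℝ} (huv : u ≤ v) :
    ‖∫ ξ in u..v, f ξ‖ ≤ (B.card + 1) * M := by
  have hM : 0 ≤ M := (norm_nonneg _).trans (h 0 0 le_rfl (by simp))
  suffices H : ∀ k : ℕ, ∀ u v, u ≤ v → (B.filter (· ∈ Ioo u v)).card = k →
      ‖∫ ξ in u..v, f ξ‖ ≤ (k + 1) * M by
    refine (H _ u v huv rfl).trans ?_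
    gcongr
    exact Finset.filter_subset _ _
  intro k
  induction k using Nat.strong_induction_on with
  | _ k ih =>
    intro u v huv hk
    by_cases hB : ∀ b ∈ B, b ∉ Ioo u v
    · refine (h u v huv hB).trans ?_
      have : (0 : ℝ) ≤ k := k.cast_nonneg
      nlinarith
    · push Not at hB
      obtain ⟨b, hbB, hb⟩ := hB
      -- The cut point lies in neither half, so the counts k₁, k₂ of the halves satisfy
      -- (k₁+1)+(k₂+1) ≤ k+1, and the bound is additive.
      have hsub : (B.filter (· ∈ Ioo u b)).card + (B.filter (· ∈ Ioo b v)).card + 1 ≤ k := by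
        rw [← hk, ← Finset.card_union_of_disjoint, ← Finset.card_insert_of_notMem (a := b)]
        · apply Finset.card_le_card
          intro y hy
          simp only [Finset.mem_insert, Finset.mem_union, Finset.mem_filter, mem_Ioo] at hy ⊢
          rcases hy with rfl | ⟨h1, h2, h3⟩ | ⟨h1, h2, h3⟩
          · exact ⟨hbB, hb⟩
          · exact ⟨h1, h2, h3.trans hb.2⟩
          · exact ⟨h1, hb.1.trans h2, h3⟩
        · simp
        · rw [Finset.disjoint_left]
          intro y hy hy'
          simp only [Finset.mem_filter, mem_Ioo] at hy hy'
          linarith [hy.2.2, hy'.2.1]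
      have h1 := ih _ (by omega) u b hb.1.le rfl
      have h2 := ih _ (by omega) b v hb.2.le rfl
      rw [← intervalIntegral.integral_add_adjacent_intervals (hf u b) (hf b v)]
      refine (norm_add_le _ _).trans ((add_le_add h1 h2).trans ?_)
      rw [← add_mul]
      refine mul_le_mul_of_nonneg_right ?_ hM
      have : (((B.filter (· ∈ Ioo u b)).card + (B.filter (· ∈ Ioo b v)).card + 1 : ℕ) : ℝ) ≤ k := by
        exact_mod_cast hsub
      push_cast at this
      linarith

/-! ### The symbol, the stable frequencies and the uniform kernel bound -/

theorem exists_pow_sub_eq_prod (m : ℕ) (hm : m ≠ 0) (y : ℂ) :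
    ∃ ρ : Fin m → ℂ, ∀ w : ℂ, w ^ m - y = ∏ i, (w - ρ i) := by
  set P : Polynomial ℂ := Polynomial.X ^ m - Polynomial.C y with hP
  have hmon : P.Monic := Polynomial.monic_X_pow_sub_C y hm
  have hs : P.Splits := IsAlgClosed.splits P
  have hcard : P.roots.toList.length = m := by
    rw [Multiset.length_toList, ← hs.natDegree_eq_card_roots, hP, Polynomial.natDegree_X_pow_sub_C]
  have hprod : P = (P.roots.map (fun a => Polynomial.X - Polynomial.C a)).prod := by
    conv_lhs => rw [hs.eq_prod_roots, hmon.leadingCoeff, map_one, one_mul]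
  refine ⟨fun i => P.roots.toList.get (i.cast hcard.symm), fun w => ?_⟩
  have h1 : w ^ m - y = P.eval w := by simp [hP]
  have h2 : P.eval w = (P.roots.toList.map fun a => w - a).prod := by
    conv_lhs => rw [hprod, Polynomial.eval_multiset_prod, Multiset.map_map, ← Multiset.coe_toList P.roots,
      Multiset.map_coe, Multiset.prod_coe]
    simp [Function.comp_def]
  rw [h1, h2, ← List.prod_ofFn]
  congr 1
  apply List.ext_get
  · simp [hcard]
  · intro i h1 h2
    simp

/-- The Fourier symbol of `∂_x - l`. -/
noncomputable def waveSymbol (l ξ : ℝ) : ℂ := 2 * Real.pi * Complex.I * ξ - l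

theorem continuous_waveSymbol (l : ℝ) : Continuous (waveSymbol l) := by
  unfold waveSymbol; fun_prop

/-- On the real line the conjugate of w is again affine in ξ, so 2 Re w^n is a polynomial of degree
at most n. It can vanish identically, as for l = 0 and n odd. -/
theorem exists_finset_re_waveSymbol_pow_eq_zero (n : ℕ) (l : ℝ) :
    ∃ B : Finset ℝ, B.card ≤ n ∧
      ((∀ ξ, ((waveSymbol l ξ) ^ n).re = 0) ∨ ∀ ξ, ((waveSymbol l ξ) ^ n).re = 0 → ξ ∈ B) := by
  set a : ℂ := 2 * Real.pi * Complex.I with ha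
  set Q : Polynomial ℂ := (Polynomial.C a * Polynomial.X - Polynomial.C (l : ℂ)) ^ n +
    (Polynomial.C (-a) * Polynomial.X - Polynomial.C (l : ℂ)) ^ n with hQ
  have hev : ∀ ξ : ℝ, Q.eval (ξ : ℂ) = 2 * ((waveSymbol l ξ) ^ n).re := by
    intro ξ
    have hc : -a * ξ - l = (starRingEnd ℂ) (waveSymbol l ξ) := by
      simp [waveSymbol, ha, Complex.conj_ofReal, map_ofNat]
    have h0 : a * ξ - l = waveSymbol l ξ := rfl
    have : Q.eval (ξ : ℂ) = (waveSymbol l ξ) ^ n + (starRingEnd ℂ) ((waveSymbol l ξ) ^ n) := by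
      rw [map_pow, ← hc, ← h0]; simp [hQ]
    rw [this, Complex.add_conj]
    push_cast; ring
  have hdeg : Q.natDegree ≤ n := by
    have h1 : ∀ b : ℂ, ((Polynomial.C b * Polynomial.X - Polynomial.C (l : ℂ)) ^ n).natDegree ≤ n := by
      intro b
      refine Polynomial.natDegree_pow_le.trans ?_
      have : (Polynomial.C b * Polynomial.X - Polynomial.C (l : ℂ)).natDegree ≤ 1 := by
        rw [Polynomial.natDegree_sub_C]
        exact (Polynomial.natDegree_C_mul_le _ _).trans Polynomial.natDegree_X_le
      nlinarith
    exact Polynomial.natDegree_add_le_of_degree_le (h1 a) (h1 (-a))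
  refine ⟨Q.roots.toFinset.image Complex.re, ?_, ?_⟩
  · exact Finset.card_image_le.trans ((Multiset.toFinset_card_le _).trans
      ((Polynomial.card_roots' Q).trans hdeg))
  · by_cases h0 : Q = 0
    · left
      intro ξ
      have := hev ξ
      rw [h0, Polynomial.eval_zero] at this
      have h2 : (((waveSymbol l ξ) ^ n).re : ℂ) = 0 := by
        simpa using this.symm
      exact_mod_cast h2
    · right
      intro ξ hξ
      have hr := hev ξ
      rw [hξ] at hr
      refine Finset.mem_image.2 ⟨ξ, ?_, by simp⟩
      rw [Multiset.mem_toFinset, Polynomial.mem_roots h0]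
      simpa [Polynomial.IsRoot] using hr

/-- Frequencies at which the propagator at time `τ` does not grow. -/
def decaySet (n : ℕ) (l τ : ℝ) : Set ℝ :=
  if 0 < τ then {ξ | 0 ≤ ((waveSymbol l ξ) ^ n).re} else {ξ | ((waveSymbol l ξ) ^ n).re < 0}

theorem measurableSet_decaySet (n : ℕ) (l τ : ℝ) : MeasurableSet (decaySet n l τ) := by
  have hm : Measurable fun ξ => ((waveSymbol l ξ) ^ n).re :=
    (Complex.continuous_re.comp ((continuous_waveSymbol l).pow n)).measurable
  unfold decaySet
  split_ifs
  · exact measurableSet_le measurable_const hm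
  · exact measurableSet_lt hm measurable_const

/-- The symbol of the fundamental solution of `∂_t + (∂_x - l)^n`, truncated at frequency `R`. -/
noncomputable def propagatorSymbol (n : ℕ) (l R τ : ℝ) : ℝ → ℂ :=
  (Icc (-R) R ∩ decaySet n l τ).indicator fun ξ =>
    (if 0 < τ then 1 else -1) * Complex.exp (-τ * (waveSymbol l ξ) ^ n)

theorem mul_re_nonneg_of_mem_decaySet {n : ℕ} {l τ ξ : ℝ} (h : ξ ∈ decaySet n l τ) :
    0 ≤ τ * ((waveSymbol l ξ) ^ n).re := by
  unfold decaySet at h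
  split_ifs at h with hτ
  · exact mul_nonneg hτ.le h
  · exact mul_nonneg_of_nonpos_of_nonpos (not_lt.1 hτ) (le_of_lt h)

theorem norm_propagatorSymbol_le (n : ℕ) (l R τ ξ : ℝ) : ‖propagatorSymbol n l R τ ξ‖ ≤ 1 := by
  unfold propagatorSymbol
  by_cases h : ξ ∈ Icc (-R) R ∩ decaySet n l τ
  · rw [indicator_of_mem h, norm_mul, Complex.norm_exp]
    have h1 : ‖(if 0 < τ then (1 : ℂ) else -1)‖ = 1 := by split_ifs <;> simp
    rw [h1, one_mul]
    apply Real.exp_le_one_iff.2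
    rw [← Complex.ofReal_neg, Complex.re_ofReal_mul]
    linarith [mul_re_nonneg_of_mem_decaySet h.2]
  · rw [indicator_of_notMem h]; simp

theorem measurable_propagatorSymbol (n : ℕ) (l R τ : ℝ) : Measurable (propagatorSymbol n l R τ) := by
  apply Measurable.indicator
  · have := continuous_waveSymbol l
    apply Continuous.measurable
    fun_prop
  · exact measurableSet_Icc.inter (measurableSet_decaySet n l τ)

theorem integrable_propagatorSymbol (n : ℕ) (l R τ : ℝ) :
    Integrable (propagatorSymbol n l R τ) := by
  have h1 : Integrable ((Icc (-R) R).indicator fun _ : ℝ => (1 : ℝ)) :=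
    (integrable_indicator_iff measurableSet_Icc).2 (by simp)
  refine h1.mono' (measurable_propagatorSymbol n l R τ).aestronglyMeasurable
    (Filter.Eventually.of_forall fun ξ => ?_)
  by_cases h : ξ ∈ Icc (-R) R
  · rw [indicator_of_mem h]; exact norm_propagatorSymbol_le n l R τ ξ
  · rw [indicator_of_notMem h, propagatorSymbol, indicator_of_notMem fun h' => h h'.1]; simp

/-- The dispersive phase, together with its factorized derivative. -/
theorem exists_roots_hasDerivAt_phase {n : ℕ} (hn : 2 ≤ n) (l x : ℝ) {τ : ℝ} (hτ : τ ≠ 0) :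
    ∃ z : Fin (n - 1) → ℂ, ∀ ξ : ℝ, HasDerivAt
      (fun ξ : ℝ => 2 * Real.pi * Complex.I * (x * ξ) - τ * (waveSymbol l ξ) ^ n)
      ((-τ * n * (2 * Real.pi * Complex.I) ^ n) * ∏ i, ((ξ : ℂ) - z i)) ξ := by
  set a : ℂ := 2 * Real.pi * Complex.I with ha
  have ha0 : a ≠ 0 := by simp [ha, Real.pi_ne_zero]
  have hn0 : (n : ℂ) ≠ 0 := by exact_mod_cast (by omega : n ≠ 0)
  have hτ0 : (τ : ℂ) ≠ 0 := by exact_mod_cast hτ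
  -- With a = 2πi, the phase derivative is -τna(w^{n-1} - x/(τn)). It is factored in the variable w,
  -- and then w = aξ - l is solved for ξ.
  obtain ⟨ρ, hrho⟩ := exists_pow_sub_eq_prod (n - 1) (by omega) (x / (τ * n))
  refine ⟨fun i => (l + ρ i) / a, fun ξ => ?_⟩
  have hw : HasDerivAt (fun ξ : ℝ => waveSymbol l ξ) a ξ := by
    have := (((hasDerivAt_id' ξ).ofReal_comp).const_mul a).sub_const (l : ℂ)
    simpa [waveSymbol] using this
  have h1 : HasDerivAt (fun ξ : ℝ => a * ((x : ℂ) * ξ)) (a * x) ξ := by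
    have := (((hasDerivAt_id' ξ).ofReal_comp).const_mul (x : ℂ)).const_mul a
    simpa using this
  have h2 := h1.sub ((hw.fun_pow n).const_mul (τ : ℂ))
  refine h2.congr_deriv ?_
  have hprod : a ^ (n - 1) * ∏ i : Fin (n - 1), ((ξ : ℂ) - (l + ρ i) / a) =
      (waveSymbol l ξ) ^ (n - 1) - x / (τ * n) := by
    rw [hrho, ← Fin.prod_const, ← Finset.prod_mul_distrib]
    refine Finset.prod_congr rfl fun i _ => ?_
    rw [mul_sub, mul_div_cancel₀ _ ha0, waveSymbol]
    ring
  have hpow : a ^ n = a * a ^ (n - 1) := by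
    rw [← pow_succ']; congr 1; omega
  calc _ = -τ * n * a * ((waveSymbol l ξ) ^ (n - 1) - x / (τ * n)) := by
        field_simp
        ring
    _ = _ := by rw [← hprod, hpow]; ring

theorem constant_sign_of_breakpoints {g : ℝ → ℝ} (hg : Continuous g) {u v : ℝ}
    (h : ∀ ξ ∈ Ioo u v, g ξ ≠ 0) : (∀ ξ ∈ Ioo u v, 0 < g ξ) ∨ ∀ ξ ∈ Ioo u v, g ξ < 0 := by
  by_contra! hcon
  obtain ⟨⟨a, ha, hga⟩, b, hb, hgb⟩ := hcon
  obtain ⟨c, hc, hc0⟩ := isPreconnected_Ioo.intermediate_value ha hb hg.continuousOn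
    (show (0 : ℝ) ∈ Icc (g a) (g b) from ⟨hga, hgb⟩)
  exact h c hc hc0

/-- Re w^n keeps its sign between break points, so there the frequency cutoff is all or nothing and
does not interfere with integration by parts. An identically vanishing real part counts as
nonnegative. -/
theorem decaySet_dichotomy {n : ℕ} {l τ u v : ℝ} {B : Finset ℝ}
    (hB : (∀ ξ, ((waveSymbol l ξ) ^ n).re = 0) ∨ ∀ ξ, ((waveSymbol l ξ) ^ n).re = 0 → ξ ∈ B)
    (h : ∀ b ∈ B, b ∉ Ioo u v) :
    Ioo u v ⊆ decaySet n l τ ∨ Disjoint (Ioo u v) (decaySet n l τ) := by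
  have hcont : Continuous fun ξ => ((waveSymbol l ξ) ^ n).re :=
    Complex.continuous_re.comp ((continuous_waveSymbol l).pow n)
  have key : (∀ ξ ∈ Ioo u v, 0 ≤ ((waveSymbol l ξ) ^ n).re) ∨
      ∀ ξ ∈ Ioo u v, ((waveSymbol l ξ) ^ n).re < 0 := by
    rcases hB with hB | hB
    · exact Or.inl fun ξ _ => (hB ξ).ge
    · rcases constant_sign_of_breakpoints hcont fun ξ hξ h0 => h ξ (hB ξ h0) hξ with h | h
      · exact Or.inl fun ξ hξ => (h ξ hξ).le
      · exact Or.inr h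
  unfold decaySet
  split_ifs <;> rcases key with h | h
  · exact Or.inl h
  · exact Or.inr (disjoint_left.2 fun ξ hξ h' => absurd (h ξ hξ) (not_lt.2 h'))
  · exact Or.inr (disjoint_left.2 fun ξ hξ h' => absurd (h ξ hξ) (not_le.2 h'))
  · exact Or.inl h

/-- The uniform dispersive estimate for the truncated propagator. -/
theorem norm_fourierInv_propagatorSymbol_le {n : ℕ} (hn : 2 ≤ n) (l : ℝ) {R : ℝ} (hR : 0 ≤ R)
    {τ : ℝ} (hτ : τ ≠ 0) (x : ℝ) :
    ‖∫ ξ : ℝ, Complex.exp (2 * Real.pi * Complex.I * (x * ξ)) * propagatorSymbol n l R τ ξ‖ ≤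
      (3 * n * (n + 1)) * |τ| ^ (-(1 / n : ℝ)) := by
  obtain ⟨z, hz⟩ := exists_roots_hasDerivAt_phase hn l x hτ
  obtain ⟨B₀, hB₀c, hB₀⟩ := exists_finset_re_waveSymbol_pow_eq_zero n l
  set Φ : ℝ → ℂ := fun ξ => 2 * Real.pi * Complex.I * (x * ξ) - τ * (waveSymbol l ξ) ^ n with hΦ
  set c : ℂ := -τ * n * (2 * Real.pi * Complex.I) ^ n with hc
  have hτpos : 0 < |τ| := abs_pos.2 hτ
  have hn0 : (n : ℂ) ≠ 0 := by exact_mod_cast (by omega : n ≠ 0)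
  have hc0 : c ≠ 0 := by
    simp [hc, hτ, Real.pi_ne_zero, hn0]
  -- The scale at which the trivial bound r near a root balances the bound 1/(|τ| r^{n-1}) away from
  -- the roots.
  set r : ℝ := |τ| ^ (-(1 / n : ℝ)) with hr
  have hr0 : 0 < r := Real.rpow_pos_of_pos hτpos _
  have hrn : |τ| * r ^ n = 1 := by
    rw [hr, ← Real.rpow_natCast, ← Real.rpow_mul hτpos.le]
    have : (-(1 / n : ℝ)) * n = -1 := by
      have : (n : ℝ) ≠ 0 := by exact_mod_cast (by omega : n ≠ 0)
      field_simp
    rw [this, Real.rpow_neg_one, mul_inv_cancel₀ hτpos.ne']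
  set s : ℂ := if 0 < τ then 1 else -1 with hs
  have hs1 : ‖s‖ = 1 := by rw [hs]; split_ifs <;> simp
  set F : ℝ → ℂ := (decaySet n l τ).indicator fun ξ => Complex.exp (Φ ξ) with hF
  have hΦre : ∀ ξ, (Φ ξ).re = -(τ * ((waveSymbol l ξ) ^ n).re) := by
    intro ξ
    have : Φ ξ = ((2 * Real.pi * (x * ξ) : ℝ) : ℂ) * Complex.I - (τ : ℂ) * (waveSymbol l ξ) ^ n := by
      rw [hΦ]; push_cast; ring
    rw [this, Complex.sub_re, Complex.re_ofReal_mul, Complex.re_ofReal_mul]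
    simp
  have hΦc : Continuous Φ := continuous_iff_continuousAt.2 fun ξ => (hz ξ).continuousAt
  have hF1 : ∀ ξ, ‖F ξ‖ ≤ 1 := by
    intro ξ
    by_cases h : ξ ∈ decaySet n l τ
    · rw [hF, indicator_of_mem h, Complex.norm_exp]
      apply Real.exp_le_one_iff.2
      rw [hΦre]
      linarith [mul_re_nonneg_of_mem_decaySet h]
    · rw [hF, indicator_of_notMem h]; simp
  have hFm : Measurable F := by
    apply Measurable.indicator _ (measurableSet_decaySet n l τ)
    exact (Complex.continuous_exp.comp hΦc).measurable
  have hFi : ∀ u v, IntervalIntegrable F volume u v := by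
    intro u v
    exact (intervalIntegrable_const (c := (1 : ℝ))).mono_fun hFm.aestronglyMeasurable
      (Filter.Eventually.of_forall fun ξ => by simpa using hF1 ξ)
  have hint : ∫ ξ : ℝ, Complex.exp (2 * Real.pi * Complex.I * (x * ξ)) * propagatorSymbol n l R τ ξ
      = s * ∫ ξ in (-R)..R, F ξ := by
    rw [intervalIntegral.integral_of_le (by linarith), ← integral_Icc_eq_integral_Ioc,
      ← integral_const_mul, ← integral_indicator measurableSet_Icc]
    congr 1
    ext ξ
    rw [propagatorSymbol, ← indicator_indicator]
    by_cases h1 : ξ ∈ Icc (-R) R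
    · rw [indicator_of_mem h1, indicator_of_mem h1, hF]
      by_cases h2 : ξ ∈ decaySet n l τ
      · rw [indicator_of_mem h2, indicator_of_mem h2, mul_left_comm, ← Complex.exp_add]
        congr 2
        rw [hΦ]; ring
      · rw [indicator_of_notMem h2, indicator_of_notMem h2]; simp
    · rw [indicator_of_notMem h1, indicator_of_notMem h1, mul_zero]
  rw [hint, norm_mul, hs1, one_mul]
  -- Break points: at most n sign changes and the 2(n-1) ends of the r-neighbourhoods of the real
  -- parts of the roots, hence at most 3n-1 intervals.
  set B : Finset ℝ := B₀ ∪ (Finset.univ.image (fun i => (z i).re - r) ∪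
    Finset.univ.image fun i => (z i).re + r) with hB
  have hBc : B.card ≤ n + ((n - 1) + (n - 1)) := by
    refine (Finset.card_union_le _ _).trans (add_le_add hB₀c ((Finset.card_union_le _ _).trans
      (add_le_add ?_ ?_))) <;> exact Finset.card_image_le.trans (by simp)
  have hmain : ∀ u v, u ≤ v → (∀ b ∈ B, b ∉ Ioo u v) → ‖∫ ξ in u..v, F ξ‖ ≤ (n + 1) * r := by
    intro u v huv hb
    have hn1 : (2 : ℝ) ≤ n := by exact_mod_cast hn
    rcases huv.eq_or_lt with rfl | huv'
    · simp; positivity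
    -- With no break point inside, the interval either lies within one such neighbourhood, so has
    -- length at most 2r, or keeps distance r from the real parts of all roots.
    by_cases hbad : ∃ i, u < (z i).re + r ∧ (z i).re - r < v
    · obtain ⟨i, h1, h2⟩ := hbad
      have hm1 : (z i).re - r ∈ B := by
        simp [hB]
      have hm2 : (z i).re + r ∈ B := by
        simp [hB]
      have h3 : (z i).re - r ≤ u := by
        by_contra! h; exact hb _ hm1 ⟨h, h2⟩
      have h4 : v ≤ (z i).re + r := by
        by_contra! h; exact hb _ hm2 ⟨h1, h⟩
      have := intervalIntegral.norm_integral_le_of_norm_le_const (a := u) (b := v) (f := F) (C := 1)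
        fun ξ _ => hF1 ξ
      refine this.trans ?_
      rw [abs_of_nonneg (by linarith)]
      nlinarith
    · push Not at hbad
      have hfar : ∀ i, v ≤ (z i).re - r ∨ (z i).re + r ≤ u := by
        intro i
        by_cases h : u < (z i).re + r
        · exact Or.inl (hbad i h)
        · exact Or.inr (not_lt.1 h)
      rcases decaySet_dichotomy (τ := τ) hB₀ (u := u) (v := v)
        (fun b hb' => hb b (Finset.mem_union_left _ hb')) with hd | hd
      · have hFe : ∫ ξ in u..v, F ξ = ∫ ξ in u..v, Complex.exp (Φ ξ) := by
          rw [intervalIntegral.integral_of_le huv, intervalIntegral.integral_of_le huv,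
            integral_Ioc_eq_integral_Ioo, integral_Ioc_eq_integral_Ioo]
          apply setIntegral_congr_fun measurableSet_Ioo
          intro ξ hξ
          rw [hF, indicator_of_mem (hd hξ)]
        rw [hFe]
        -- The boundary terms need the sign at the endpoints too; it extends from the open interval
        -- by closedness.
        have hre : ∀ ξ ∈ Icc u v, (Φ ξ).re ≤ 0 := by
          rw [← closure_Ioo huv'.ne]
          intro ξ hξ
          have hcl : IsClosed {ξ | (Φ ξ).re ≤ 0} :=
            isClosed_le (Complex.continuous_re.comp hΦc) continuous_const
          refine closure_minimal (fun y hy => ?_) hcl hξ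
          change (Φ y).re ≤ 0
          rw [hΦre]
          linarith [mul_re_nonneg_of_mem_decaySet (hd hy)]
        refine (norm_integral_cexp_le_of_roots_far hc0 z hz huv hr0 hre hfar).trans ?_
        have hcn : |τ| ≤ ‖c‖ := by
          rw [hc, norm_mul, norm_mul, norm_neg, Complex.norm_real, norm_pow, Real.norm_eq_abs]
          have h1 : (1 : ℝ) ≤ ‖(n : ℂ)‖ := by
            rw [Complex.norm_natCast]; linarith
          have h2 : (1 : ℝ) ≤ ‖(2 * Real.pi * Complex.I : ℂ)‖ ^ n := by
            apply one_le_pow₀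
            simp [abs_of_pos Real.pi_pos]
            linarith [Real.pi_gt_three]
          calc |τ| = |τ| * 1 * 1 := by ring
            _ ≤ _ := by gcongr
        have hrr : r ^ n = r ^ (n - 1) * r := by
          rw [← pow_succ]; congr 1; omega
        have h5 : ((n - 1 : ℕ) : ℝ) + 2 = n + 1 := by
          rw [Nat.cast_sub (by omega)]; push_cast; ring
        rw [h5, div_le_iff₀ (by positivity)]
        have : 1 ≤ r * (‖c‖ * r ^ (n - 1)) := by
          calc 1 = |τ| * r ^ n := hrn.symm
            _ ≤ ‖c‖ * r ^ n := by gcongr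
            _ = _ := by rw [hrr]; ring
        rw [mul_assoc]
        exact le_mul_of_one_le_right (by positivity) this
      · have hFe : ∫ ξ in u..v, F ξ = 0 := by
          rw [intervalIntegral.integral_of_le huv, integral_Ioc_eq_integral_Ioo]
          rw [setIntegral_congr_fun measurableSet_Ioo (g := fun _ => (0 : ℂ))]
          · simp
          intro ξ hξ
          rw [hF, indicator_of_notMem (disjoint_left.1 hd hξ)]
        rw [hFe, norm_zero]
        positivity
  refine (norm_integral_le_of_breakpoints hFi B hmain (by linarith)).trans ?_
  have : (B.card : ℝ) + 1 ≤ 3 * n := by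
    have : B.card + 1 ≤ 3 * n := by omega
    exact_mod_cast this
  calc _ ≤ (3 * n : ℝ) * ((n + 1) * r) := by gcongr
    _ = _ := by ring

/-! ### Layer-cake formulas and real interpolation -/

theorem lintegral_Ioo_rpow_sub_one {e : ℝ} (he : 0 < e) {M : ℝ} (hM : 0 ≤ M) :
    ∫⁻ t in Ioo 0 M, ENNReal.ofReal (t ^ (e - 1)) = ENNReal.ofReal (M ^ e / e) := by
  have hi : IntervalIntegrable (fun t : ℝ => t ^ (e - 1)) volume 0 M :=
    intervalIntegral.intervalIntegrable_rpow' (by linarith)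
  rw [intervalIntegrable_iff_integrableOn_Ioo_of_le hM] at hi
  rw [← ofReal_integral_eq_lintegral_ofReal hi]
  · rw [← integral_Ioc_eq_integral_Ioo, ← intervalIntegral.integral_of_le hM,
      integral_rpow (Or.inl (by linarith))]
    simp [Real.zero_rpow he.ne']
  · filter_upwards [self_mem_ae_restrict measurableSet_Ioo] with t ht
    exact Real.rpow_nonneg ht.1.le _

theorem lintegral_Ioi_indicator_rpow_sub_one {e : ℝ} (he : 0 < e) (y : ℝ≥0∞) :
    ∫⁻ t in Ioi (0 : ℝ), {t : ℝ | ENNReal.ofReal t < y}.indicator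
      (fun t => ENNReal.ofReal (t ^ (e - 1))) t = ENNReal.ofReal (1 / e) * y ^ e := by
  have hms : ∀ y : ℝ≥0∞, MeasurableSet {t : ℝ | ENNReal.ofReal t < y} := fun y =>
    measurableSet_lt ENNReal.measurable_ofReal measurable_const
  have key : ∀ M : ℝ, 0 ≤ M → ∫⁻ t in Ioi (0 : ℝ), {t : ℝ | ENNReal.ofReal t < ENNReal.ofReal M}.indicator
      (fun t => ENNReal.ofReal (t ^ (e - 1))) t = ENNReal.ofReal (1 / e) * ENNReal.ofReal M ^ e := by
    intro M hM
    rw [lintegral_indicator (hms _), Measure.restrict_restrict (hms _)]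
    have : {t : ℝ | ENNReal.ofReal t < ENNReal.ofReal M} ∩ Ioi 0 = Ioo 0 M := by
      ext t
      simp only [mem_inter_iff, mem_ofPred_eq, mem_Ioi, mem_Ioo]
      constructor
      · rintro ⟨h1, h2⟩
        exact ⟨h2, (ENNReal.ofReal_lt_ofReal_iff_of_nonneg h2.le).1 h1⟩
      · rintro ⟨h1, h2⟩
        exact ⟨(ENNReal.ofReal_lt_ofReal_iff_of_nonneg h1.le).2 h2, h1⟩
    rw [this, lintegral_Ioo_rpow_sub_one he hM, ENNReal.ofReal_rpow_of_nonneg hM he.le,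
      ← ENNReal.ofReal_mul (by positivity)]
    congr 1
    ring
  by_cases hy : y = ⊤
  · subst hy
    rw [ENNReal.top_rpow_of_pos he, ENNReal.mul_top (by simpa using he)]
    rw [eq_top_iff]
    refine ENNReal.le_of_forall_nnreal_lt fun r _ => ?_
    -- The finite level whose integral is exactly r; hence the integral at y = ⊤ exceeds every r.
    set M : ℝ := (e * r) ^ (1 / e) with hM
    have hM0 : 0 ≤ M := by positivity
    have h1 : ENNReal.ofReal (1 / e) * ENNReal.ofReal M ^ e = r := by
      rw [ENNReal.ofReal_rpow_of_nonneg hM0 he.le, ← ENNReal.ofReal_mul (by positivity), hM,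
        ← Real.rpow_mul (by positivity), one_div_mul_cancel he.ne', Real.rpow_one, ← mul_assoc,
        one_div_mul_cancel he.ne', one_mul, ENNReal.ofReal_coe_nnreal]
    rw [← h1, ← key M hM0]
    gcongr with t
    exact le_top
  · rw [← ENNReal.ofReal_toReal (a := y) hy]
    exact key _ ENNReal.toReal_nonneg

/-- Tonelli applied to the pointwise layer-cake formula. The value ⊤ is allowed for F, so
convolutions need not be known finite in advance. -/
theorem lintegral_rpow_eq_lintegral_meas_lt_mul_ennreal {α : Type*} [MeasurableSpace α]
    {μ : Measure α} [SFinite μ] {F : α → ℝ≥0∞} (hF : Measurable F) {q : ℝ} (hq : 0 < q) :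
    ∫⁻ x, F x ^ q ∂μ =
      ENNReal.ofReal q * ∫⁻ t in Ioi (0 : ℝ), μ {x | ENNReal.ofReal t < F x} *
        ENNReal.ofReal (t ^ (q - 1)) := by
  have h1 : ∀ x, F x ^ q = ENNReal.ofReal q * ∫⁻ t in Ioi (0 : ℝ),
      {t : ℝ | ENNReal.ofReal t < F x}.indicator (fun t => ENNReal.ofReal (t ^ (q - 1))) t := by
    intro x
    rw [lintegral_Ioi_indicator_rpow_sub_one hq, ← mul_assoc, ← ENNReal.ofReal_mul hq.le,
      mul_one_div_cancel hq.ne', ENNReal.ofReal_one, one_mul]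
  simp_rw [h1]
  have hset : MeasurableSet {z : α × ℝ | ENNReal.ofReal z.2 < F z.1} :=
    measurableSet_lt (ENNReal.measurable_ofReal.comp measurable_snd) (hF.comp measurable_fst)
  have hm : Measurable (Function.uncurry fun (x : α) (t : ℝ) =>
      {t : ℝ | ENNReal.ofReal t < F x}.indicator (fun t => ENNReal.ofReal (t ^ (q - 1))) t) := by
    have : (Function.uncurry fun (x : α) (t : ℝ) =>
      {t : ℝ | ENNReal.ofReal t < F x}.indicator (fun t => ENNReal.ofReal (t ^ (q - 1))) t)
      = {z : α × ℝ | ENNReal.ofReal z.2 < F z.1}.indicator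
        fun z => ENNReal.ofReal (z.2 ^ (q - 1)) := by
      ext ⟨x, t⟩; rfl
    rw [this]
    exact Measurable.indicator (by fun_prop) hset
  rw [lintegral_const_mul _ (Measurable.lintegral_prod_right hm),
    lintegral_lintegral_swap hm.aemeasurable]
  congr 1
  refine lintegral_congr fun t => ?_
  have h2 : ∀ x, {t : ℝ | ENNReal.ofReal t < F x}.indicator
      (fun t => ENNReal.ofReal (t ^ (q - 1))) t =
      {x | ENNReal.ofReal t < F x}.indicator (fun _ => ENNReal.ofReal (t ^ (q - 1))) x :=
    fun x => rfl
  simp_rw [h2]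
  rw [lintegral_indicator_const (measurableSet_lt measurable_const hF), mul_comm]

/-- Strong-type bound from a distributional bound by an integral over superlevel sets. -/
theorem lintegral_rpow_le_of_meas_lt_le {α β : Type*} [MeasurableSpace α] [MeasurableSpace β]
    {μ : Measure α} {ν : Measure β} [SFinite μ] [SFinite ν] {F : α → ℝ≥0∞} (hF : Measurable F)
    {w b : β → ℝ≥0∞} (hw : Measurable w) (hb : Measurable b) {q d : ℝ} (hq : 0 < q) (hdq : d < q)
    (c : ℝ≥0∞)
    (h : ∀ t : ℝ, 0 < t → μ {x | ENNReal.ofReal t < F x} ≤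
      c * ENNReal.ofReal (t ^ (-d)) * ∫⁻ y in {y | ENNReal.ofReal t < b y}, w y ∂ν) :
    ∫⁻ x, F x ^ q ∂μ ≤ ENNReal.ofReal (q / (q - d)) * c * ∫⁻ y, w y * b y ^ (q - d) ∂ν := by
  rw [lintegral_rpow_eq_lintegral_meas_lt_mul_ennreal hF hq]
  have hset : MeasurableSet {z : ℝ × β | ENNReal.ofReal z.1 < b z.2} :=
    measurableSet_lt (ENNReal.measurable_ofReal.comp measurable_fst) (hb.comp measurable_snd)
  -- After the distributional bound and Tonelli, t^{q-d-1} is integrated over 0 < t < b(y). It is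
  -- integrable at 0 because d < q and yields b(y)^{q-d}/(q-d).
  set G : ℝ → β → ℝ≥0∞ := fun t y =>
    {t : ℝ | ENNReal.ofReal t < b y}.indicator (fun t => ENNReal.ofReal (t ^ (q - d - 1))) t * w y
    with hG
  have hGm : Measurable (Function.uncurry G) := by
    have : Function.uncurry G = fun z => {z : ℝ × β | ENNReal.ofReal z.1 < b z.2}.indicator
        (fun z => ENNReal.ofReal (z.1 ^ (q - d - 1))) z * w z.2 := by
      ext ⟨t, y⟩; rfl
    rw [this]
    exact (Measurable.indicator (by fun_prop) hset).mul (hw.comp measurable_snd)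
  calc _ ≤ ENNReal.ofReal q * ∫⁻ t in Ioi (0 : ℝ), c * ∫⁻ y, G t y ∂ν := by
        gcongr ENNReal.ofReal q * ?_
        refine setLIntegral_mono' measurableSet_Ioi fun t ht => ?_
        have ht : 0 < t := ht
        calc _ ≤ (c * ENNReal.ofReal (t ^ (-d)) * ∫⁻ y in {y | ENNReal.ofReal t < b y}, w y ∂ν) *
              ENNReal.ofReal (t ^ (q - 1)) := by gcongr; exact h t ht
          _ = c * (ENNReal.ofReal (t ^ (q - d - 1)) *
              ∫⁻ y in {y | ENNReal.ofReal t < b y}, w y ∂ν) := by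
            have : ENNReal.ofReal (t ^ (q - d - 1)) =
                ENNReal.ofReal (t ^ (-d)) * ENNReal.ofReal (t ^ (q - 1)) := by
              rw [← ENNReal.ofReal_mul (by positivity), ← Real.rpow_add ht]
              congr 2; ring
            rw [this]; ring
          _ = c * ∫⁻ y, G t y ∂ν := by
            congr 1
            rw [← lintegral_indicator (measurableSet_lt measurable_const hb),
              ← lintegral_const_mul _ (hw.indicator (measurableSet_lt measurable_const hb))]
            refine lintegral_congr fun y => ?_
            by_cases hy : ENNReal.ofReal t < b y
            · simp [hG, hy]
            · simp [hG, hy]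
    _ = ENNReal.ofReal q * c * ∫⁻ y, (∫⁻ t in Ioi (0 : ℝ), G t y) ∂ν := by
        rw [lintegral_const_mul _ (Measurable.lintegral_prod_right hGm), ← mul_assoc,
          lintegral_lintegral_swap hGm.aemeasurable]
    _ = ENNReal.ofReal q * c * ∫⁻ y, ENNReal.ofReal (1 / (q - d)) * (w y * b y ^ (q - d)) ∂ν := by
        congr 1
        refine lintegral_congr fun y => ?_
        rw [hG]
        simp only
        rw [lintegral_mul_const, lintegral_Ioi_indicator_rpow_sub_one (by linarith)]
        · ring
        · exact Measurable.indicator (by fun_prop)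
            (measurableSet_lt ENNReal.measurable_ofReal measurable_const)
    _ = _ := by
        rw [lintegral_const_mul (f := fun y => w y * b y ^ (q - d)) _ (hw.mul (hb.pow_const _)), div_eq_mul_one_div q,
          ENNReal.ofReal_mul hq.le]
        ring

/-- The identity 2 - (r-2)/(r-1) = r/(r-1): a cut at a level proportional to |φ|^{-1/(r-1)} turns
the weight |φ|² into the dual power. -/
theorem sq_mul_mul_rpow_neg_rpow_le {r : ℝ} (hr : 2 < r) (c x : ℝ≥0∞) (hx : x ≠ ⊤) :
    x ^ 2 * (c * x ^ (-(1 / (r - 1)))) ^ (r - 2) ≤ c ^ (r - 2) * x ^ (r / (r - 1)) := by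
  by_cases h0 : x = 0
  · simp [h0]
  have h1 : r - 1 ≠ 0 := by linarith
  rw [ENNReal.mul_rpow_of_nonneg _ _ (by linarith), ← ENNReal.rpow_mul, mul_left_comm,
    ← ENNReal.rpow_natCast, ← ENNReal.rpow_add _ _ h0 hx]
  have : ((2 : ℕ) : ℝ) + -(1 / (r - 1)) * (r - 2) = r / (r - 1) := by
    push_cast
    field_simp
    ring
  rw [this]

/-- Real interpolation between `L¹ → L^∞` and `L² → L²` for a linear operator: the
`L^{r'} → L^r` bound, with the sharp dependence on the `L¹ → L^∞` norm `A`. -/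
theorem lintegral_enorm_rpow_le_of_L1_Linfty_of_L2 {r : ℝ} (hr : 2 < r) {A : ℝ≥0} (hA : A ≠ 0)
    {T : (ℝ → ℂ) → ℝ → ℂ}
    (hTm : ∀ φ, MemLp φ 1 → MemLp φ 2 → Measurable (T φ))
    (hTadd : ∀ φ ψ, MemLp φ 1 → MemLp φ 2 → MemLp ψ 1 → MemLp ψ 2 → T (φ + ψ) = T φ + T ψ)
    (hT1 : ∀ φ, MemLp φ 1 → MemLp φ 2 → ∀ x, ‖T φ x‖ₑ ≤ A * ∫⁻ y, ‖φ y‖ₑ)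
    (hT2 : ∀ φ, MemLp φ 1 → MemLp φ 2 → ∫⁻ x, ‖T φ x‖ₑ ^ 2 ≤ ∫⁻ x, ‖φ x‖ₑ ^ 2)
    {φ : ℝ → ℂ} (hφ : Measurable φ) (hφ1 : MemLp φ 1) (hφ2 : MemLp φ 2) :
    ∫⁻ x, ‖T φ x‖ₑ ^ r ≤ ENNReal.ofReal (r / (r - 2)) * 4 * 2 ^ (r - 2) *
      ((A : ℝ≥0∞) ^ (r - 2) * (∫⁻ x, ‖φ x‖ₑ ^ (r / (r - 1))) ^ (r - 1)) := by
  have hr1 : 0 < r - 1 := by linarith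
  have hr2 : 0 < r - 2 := by linarith
  set s : ℝ := 1 / (r - 1) with hs
  have hs0 : 0 < s := by positivity
  have hs1 : r / (r - 1) = 1 + s := by rw [hs]; field_simp; ring
  set N : ℝ≥0∞ := ∫⁻ x, ‖φ x‖ₑ ^ (r / (r - 1)) with hN
  have hA0 : (A : ℝ≥0∞) ≠ 0 := by exact_mod_cast hA
  have hφe : Measurable fun x => ‖φ x‖ₑ := hφ.enorm
  by_cases hN0 : N = 0
  · have hz : ∀ᵐ x, ‖φ x‖ₑ ^ (r / (r - 1)) = 0 := by
      rw [hN, lintegral_eq_zero_iff (hφe.pow_const _)] at hN0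
      exact hN0
    have h0 : ∫⁻ y, ‖φ y‖ₑ = 0 := by
      rw [lintegral_eq_zero_iff hφe]
      filter_upwards [hz] with x hx
      exact (ENNReal.rpow_eq_zero_iff_of_pos (by rw [hs1]; positivity)).1 hx
    have h1 : ∀ x, ‖T φ x‖ₑ = 0 := by
      intro x
      have := hT1 φ hφ1 hφ2 x
      rw [h0, mul_zero] at this
      exact le_antisymm this zero_le
    simp [h1, ENNReal.zero_rpow_of_pos (show 0 < r by linarith)]
  by_cases hNt : N = ⊤
  · rw [hNt, ENNReal.top_rpow_of_pos hr1, ENNReal.mul_top, ENNReal.mul_top]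
    · exact le_top
    · have : ENNReal.ofReal (r / (r - 2)) ≠ 0 := by
        have : 0 < r / (r - 2) := by positivity
        simpa using this
      have h2 : (2 : ℝ≥0∞) ^ (r - 2) ≠ 0 := by
        simp [ENNReal.rpow_eq_zero_iff]
      simp [this, h2]
    · simp [ENNReal.rpow_eq_zero_iff, hA]
  -- At level t the set b > t is where |φ| is small, because the exponent is negative. This small
  -- part is measured in L², the large part in L¹. The factor 2AN makes the image of the large part
  -- at most t/2 everywhere.
  set b : ℝ → ℝ≥0∞ := fun y => (2 * A * N) * ‖φ y‖ₑ ^ (-s) with hb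
  have hbm : Measurable b := (hφe.pow_const _).const_mul _
  have h2AN0 : 2 * A * N ≠ 0 := by simp [hA, hN0]
  have h2ANt : 2 * A * N ≠ ⊤ := by
    exact ENNReal.mul_ne_top (ENNReal.mul_ne_top (by simp) (by simp)) hNt
  have main := lintegral_rpow_le_of_meas_lt_le (μ := volume) (ν := volume)
    (F := fun x => ‖T φ x‖ₑ) (hTm φ hφ1 hφ2).enorm (w := fun y => ‖φ y‖ₑ ^ 2) (hφe.pow_const _) hbm
    (q := r) (d := 2) (by linarith) hr 4 ?_
  · refine main.trans ?_
    have h1 : ∫⁻ y, ‖φ y‖ₑ ^ 2 * b y ^ (r - 2) ≤ (2 * A * N) ^ (r - 2) * N := by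
      calc _ ≤ ∫⁻ y, (2 * A * N) ^ (r - 2) * ‖φ y‖ₑ ^ (r / (r - 1)) := ?_
        _ = _ := lintegral_const_mul _ (hφe.pow_const _)
      refine lintegral_mono fun y => ?_
      exact sq_mul_mul_rpow_neg_rpow_le hr _ _ (by simp)
    refine (mul_le_mul_right h1 _).trans (le_of_eq ?_)
    rw [ENNReal.mul_rpow_of_nonneg _ _ hr2.le, ENNReal.mul_rpow_of_nonneg _ _ hr2.le]
    have : N ^ (r - 1) = N ^ (r - 2) * N := by
      conv_rhs => rw [← ENNReal.rpow_one N, ← ENNReal.rpow_mul, one_mul, ← ENNReal.rpow_add _ _ hN0 hNt]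
      congr 1; ring
    rw [this]
    ring
  intro t ht
  set a : ℝ≥0∞ := ENNReal.ofReal t with ha
  have ha0 : a ≠ 0 := by simpa [ha] using ht
  have hat : a ≠ ⊤ := by simp [ha]
  set S : Set ℝ := {y | a < b y} with hS
  have hSm : MeasurableSet S := measurableSet_lt measurable_const hbm
  set φs : ℝ → ℂ := S.indicator φ with hφs
  set φb : ℝ → ℂ := Sᶜ.indicator φ with hφb
  have hsum : φb + φs = φ := by rw [add_comm]; exact indicator_self_add_compl S φ
  have hs1' : MemLp φs 1 := hφ1.indicator hSm
  have hs2' : MemLp φs 2 := hφ2.indicator hSm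
  have hb1' : MemLp φb 1 := hφ1.indicator hSm.compl
  have hb2' : MemLp φb 2 := hφ2.indicator hSm.compl
  have hbig : ∫⁻ y, ‖φb y‖ₑ ≤ a / (2 * A) := by
    -- Off S one has 2AN|φ|^{-s} ≤ a, that is 2AN|φ| ≤ a|φ|^{1+s}, and 1+s is the dual exponent.
    have h1 : (2 * A * N) * ∫⁻ y, ‖φb y‖ₑ ≤ a * N := by
      rw [← lintegral_const_mul _ (hφ.indicator hSm.compl).enorm]
      calc _ ≤ ∫⁻ y, a * ‖φ y‖ₑ ^ (r / (r - 1)) := ?_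
        _ = _ := lintegral_const_mul _ (hφe.pow_const _)
      refine lintegral_mono fun y => ?_
      by_cases hy : y ∈ S
      · simp [hy]
      · have hyb : b y ≤ a := not_lt.1 hy
        simp only [indicator_of_mem (mem_compl hy)]
        have hy0 : ‖φ y‖ₑ ≠ 0 := by
          intro h0
          rw [hb] at hyb
          simp only [h0, ENNReal.zero_rpow_of_neg (neg_lt_zero.2 hs0), ENNReal.mul_top h2AN0] at hyb
          exact hat (top_le_iff.1 hyb)
        have h3 : ‖φ y‖ₑ ^ (r / (r - 1)) = ‖φ y‖ₑ * ‖φ y‖ₑ ^ s := by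
          rw [hs1, ENNReal.rpow_add _ _ hy0 (by simp), ENNReal.rpow_one]
        have h4 : b y * ‖φ y‖ₑ ^ s = 2 * A * N := by
          rw [hb]
          simp only
          rw [mul_assoc, ← ENNReal.rpow_add _ _ hy0 (by simp)]
          simp
        rw [h3, ← h4]
        calc b y * ‖φ y‖ₑ ^ s * ‖φ y‖ₑ ≤ a * ‖φ y‖ₑ ^ s * ‖φ y‖ₑ := by gcongr
          _ = _ := by ring
    rw [ENNReal.le_div_iff_mul_le (by simp [hA]) (by right; exact hat)]
    rw [mul_comm (2 * (A : ℝ≥0∞)) N, mul_assoc, mul_comm a N] at h1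
    rw [mul_comm]
    exact (ENNReal.mul_le_mul_iff_right hN0 hNt).1 h1
  -- The large part uses up at most half of the level, so the small part must reach the other half;
  -- Chebyshev in L² then applies.
  have hsub : {x | a < ‖T φ x‖ₑ} ⊆ {x | (a / 2) ^ 2 ≤ ‖T φs x‖ₑ ^ 2} := by
    intro x hx
    have hx : a < ‖T φ x‖ₑ := hx
    rw [mem_ofPred_eq]
    gcongr
    by_contra! hlt
    have h1 : ‖T φb x‖ₑ ≤ a / 2 := by
      refine (hT1 φb hb1' hb2' x).trans ((mul_le_mul_right hbig _).trans (le_of_eq ?_))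
      rw [ENNReal.div_eq_inv_mul, ENNReal.div_eq_inv_mul,
        ENNReal.mul_inv (by simp) (by simp), mul_comm (2⁻¹ : ℝ≥0∞), ← mul_assoc, ← mul_assoc,
        ENNReal.mul_inv_cancel hA0 (by simp), one_mul]
    have h2 : ‖T φ x‖ₑ ≤ a / 2 + a / 2 := by
      rw [← hsum, hTadd φb φs hb1' hb2' hs1' hs2']
      exact (enorm_add_le _ _).trans (add_le_add h1 hlt.le)
    rw [ENNReal.add_halves] at h2
    exact absurd hx (not_lt.2 h2)
  have hcheb : (a / 2) ^ 2 * volume {x | (a / 2) ^ 2 ≤ ‖T φs x‖ₑ ^ 2} ≤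
      ∫⁻ y in S, ‖φ y‖ₑ ^ 2 := by
    refine (mul_meas_ge_le_lintegral ((hTm φs hs1' hs2').enorm.pow_const 2) _).trans
      ((hT2 φs hs1' hs2').trans (le_of_eq ?_))
    rw [← lintegral_indicator hSm]
    refine lintegral_congr fun y => ?_
    by_cases hy : y ∈ S <;> simp [hφs, hy]
  have hfac : 4 * ENNReal.ofReal (t ^ (-2 : ℝ)) * (a / 2) ^ 2 = 1 := by
    have h4 : (4 : ℝ≥0∞) = ENNReal.ofReal 4 := by simp
    have h2 : (2 : ℝ≥0∞) = ENNReal.ofReal 2 := by simp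
    rw [ha, h2, ← ENNReal.ofReal_div_of_pos (by norm_num), ← ENNReal.ofReal_pow (by positivity), h4,
      ← ENNReal.ofReal_mul (by norm_num), ← ENNReal.ofReal_mul (by positivity)]
    rw [Real.rpow_neg ht.le, Real.rpow_ofNat]
    rw [← ENNReal.ofReal_one]
    congr 1
    field_simp
    norm_num
  calc volume {x | a < ‖T φ x‖ₑ} ≤ volume {x | (a / 2) ^ 2 ≤ ‖T φs x‖ₑ ^ 2} := measure_mono hsub
    _ = 4 * ENNReal.ofReal (t ^ (-2 : ℝ)) * ((a / 2) ^ 2 *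
        volume {x | (a / 2) ^ 2 ≤ ‖T φs x‖ₑ ^ 2}) := by rw [← mul_assoc, hfac, one_mul]
    _ ≤ _ := by gcongr

/-! ### Hardy–Littlewood–Sobolev on the line -/

theorem lintegral_comp_abs {f : ℝ → ℝ≥0∞} (hf : Measurable f) :
    ∫⁻ x, f |x| = 2 * ∫⁻ x in Ioi (0 : ℝ), f x := by
  rw [← lintegral_add_compl _ (measurableSet_Ioi (a := (0 : ℝ))), two_mul]
  congr 1
  · exact setLIntegral_congr_fun measurableSet_Ioi fun x hx => by
      simp only [abs_of_pos (mem_Ioi.1 hx)]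
  · have h1 := (Measure.measurePreserving_neg (volume : Measure ℝ)).setLIntegral_comp_preimage
      (measurableSet_Ici (a := (0 : ℝ))) hf
    rw [compl_Ioi, setLIntegral_congr Ioi_ae_eq_Ici, ← h1]
    have : (Neg.neg ⁻¹' Ici (0 : ℝ)) = Iic 0 := by ext; simp
    rw [this]
    exact setLIntegral_congr_fun measurableSet_Iic fun x hx => by
      simp only [abs_of_nonpos (mem_Iic.1 hx)]

/-- The kernel of the fractional integral of order `1 - a` on the line. -/
noncomputable def rieszKernel (a τ : ℝ) : ℝ≥0∞ := ENNReal.ofReal (|τ| ^ (-a))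

theorem measurable_rieszKernel (a : ℝ) : Measurable (rieszKernel a) := by
  unfold rieszKernel; fun_prop

theorem lintegral_rieszKernel_near {a ρ : ℝ} (ha : a < 1) (hρ : 0 < ρ) :
    ∫⁻ τ, {τ : ℝ | |τ| < ρ}.indicator (rieszKernel a) τ =
      ENNReal.ofReal (2 / (1 - a) * ρ ^ (1 - a)) := by
  have h1 : ∀ τ : ℝ, {τ : ℝ | |τ| < ρ}.indicator (rieszKernel a) τ =
      (Iio ρ).indicator (fun t : ℝ => ENNReal.ofReal (t ^ (-a))) |τ| := by
    intro τ
    by_cases h : |τ| < ρ <;> simp [h, rieszKernel]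
  simp_rw [h1]
  rw [lintegral_comp_abs (Measurable.indicator (by fun_prop) measurableSet_Iio),
    lintegral_indicator measurableSet_Iio, Measure.restrict_restrict measurableSet_Iio]
  have h2 : Iio ρ ∩ Ioi (0 : ℝ) = Ioo 0 ρ := by rw [inter_comm, Ioi_inter_Iio]
  have h3 := lintegral_Ioo_rpow_sub_one (e := 1 - a) (by linarith) hρ.le
  rw [show (1 - a) - 1 = -a by ring] at h3
  rw [h2, h3, show (2 : ℝ≥0∞) = ENNReal.ofReal 2 by simp, ← ENNReal.ofReal_mul (by norm_num)]
  congr 1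
  ring

/-- The q-th power of the kernel is |τ|^{-2}, integrable away from 0: the far part lies in the space
dual to that of the density. -/
theorem lintegral_rieszKernel_far {q ρ : ℝ} (hq : 0 < q) (hρ : 0 < ρ) :
    ∫⁻ τ, ({τ : ℝ | |τ| < ρ}ᶜ.indicator (rieszKernel (2 / q)) τ) ^ q = ENNReal.ofReal (2 / ρ) := by
  have h1 : ∀ τ : ℝ, ({τ : ℝ | |τ| < ρ}ᶜ.indicator (rieszKernel (2 / q)) τ) ^ q =
      (Ici ρ).indicator (fun t : ℝ => ENNReal.ofReal (t ^ (-2 : ℝ))) |τ| := by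
    intro τ
    by_cases h : |τ| < ρ
    · simp [h, not_le.2 h, ENNReal.zero_rpow_of_pos hq]
    · have h' : ρ ≤ |τ| := not_lt.1 h
      rw [indicator_of_mem (by simpa using h'), indicator_of_mem (by simpa using h'), rieszKernel,
        ENNReal.ofReal_rpow_of_nonneg (by positivity) hq.le, ← Real.rpow_mul (abs_nonneg _)]
      congr 2
      field_simp
  simp_rw [h1]
  rw [lintegral_comp_abs (Measurable.indicator (by fun_prop) measurableSet_Ici),
    lintegral_indicator measurableSet_Ici, Measure.restrict_restrict measurableSet_Ici]
  have h2 : Ici ρ ∩ Ioi (0 : ℝ) = Ici ρ := inter_eq_left.2 fun x hx => lt_of_lt_of_le hρ hx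
  rw [h2, ← setLIntegral_congr Ioi_ae_eq_Ici, ← ofReal_integral_eq_lintegral_ofReal]
  · rw [integral_Ioi_rpow_of_lt (by norm_num) hρ, show (2 : ℝ≥0∞) = ENNReal.ofReal 2 by simp,
      ← ENNReal.ofReal_mul (by norm_num)]
    congr 1
    rw [show (-2 : ℝ) + 1 = -1 by norm_num, Real.rpow_neg_one]
    field_simp
  · exact integrableOn_Ioi_rpow_of_lt (by norm_num) hρ
  · filter_upwards [self_mem_ae_restrict measurableSet_Ioi] with t ht
    exact Real.rpow_nonneg (hρ.le.trans (le_of_lt ht)) _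

/-- Hardy–Littlewood–Sobolev for a normalized density. -/
theorem lintegral_rieszKernel_conv_rpow_le_of_eq_one {q : ℝ} (hq : 2 < q) :
    ∃ C : ℝ≥0, ∀ φ : ℝ → ℝ≥0∞, Measurable φ → ∫⁻ s, φ s ^ (q / (q - 1)) = 1 →
      ∫⁻ t, (∫⁻ s, rieszKernel (2 / q) (t - s) * φ s) ^ q ≤ C := by
  set a : ℝ := 2 / q with ha
  have hq0 : 0 < q := by linarith
  have ha1 : a < 1 := by rw [ha, div_lt_one hq0]; exact hq
  have hqa : q * (1 - a) = q - 2 := by rw [ha]; field_simp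
  set κ : ℝ := 2 / (1 - a) with hκ
  have hκ0 : 0 < κ := div_pos two_pos (by linarith)
  -- The value of D for which, with ρ and γ chosen below, the near kernel has mass exactly t/(4γ).
  set D : ℝ := 4 * κ * 2 ^ (1 - a) * 4 ^ (q - 2) with hD
  have hD0 : 0 < D := by positivity
  have hq1 : 0 < q - 1 := by linarith
  refine ⟨(q * (D / 2) * D ^ (1 / (q - 1))).toNNReal, fun φ hφ hN => ?_⟩
  set k := rieszKernel a with hk
  have hkm : Measurable k := measurable_rieszKernel a
  have hconvm : ∀ {k' φ' : ℝ → ℝ≥0∞}, Measurable k' → Measurable φ' →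
      Measurable fun t => ∫⁻ s, k' (t - s) * φ' s := by
    intro k' φ' h1 h2
    apply Measurable.lintegral_prod_right' (f := fun z : ℝ × ℝ => k' (z.1 - z.2) * φ' z.2)
    fun_prop
  set F : ℝ → ℝ≥0∞ := fun t => ∫⁻ s, k (t - s) * φ s with hF
  set b : ℝ → ℝ≥0∞ := fun s => (ENNReal.ofReal D * φ s) ^ (1 / (q - 1)) with hb
  have hbm : Measurable b := (hφ.const_mul _).pow_const _
  have main := lintegral_rpow_le_of_meas_lt_le (μ := volume) (ν := volume) (F := F) (w := φ)
    (b := b) (hconvm hkm hφ) hφ hbm (q := q) (d := q - 1) hq0 (by linarith)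
    (ENNReal.ofReal (D / 2)) ?_
  · refine main.trans ?_
    have h1 : ∀ s, φ s * b s ^ (q - (q - 1)) =
        ENNReal.ofReal (D ^ (1 / (q - 1))) * φ s ^ (q / (q - 1)) := by
      intro s
      rw [sub_sub_cancel, ENNReal.rpow_one, hb]
      simp only
      rw [ENNReal.mul_rpow_of_nonneg _ _ (by positivity), ENNReal.ofReal_rpow_of_pos hD0,
        mul_left_comm]
      congr 1
      conv_lhs => rw [← ENNReal.rpow_one (φ s), ← ENNReal.rpow_mul, one_mul,
        ← ENNReal.rpow_add_of_nonneg _ _ zero_le_one (by positivity)]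
      congr 1
      field_simp
      ring
    simp_rw [h1]
    rw [lintegral_const_mul _ (hφ.pow_const _), hN, mul_one, sub_sub_cancel, div_one,
      ← ENNReal.ofReal_mul hq0.le, ← ENNReal.ofReal_mul (by positivity)]
    exact le_rfl
  intro t ht
  -- The radius ρ gives the far kernel L^q norm t/4. The height γ defined next is the one at which b
  -- crosses t, so S is the set where φ > γ.
  set ρ : ℝ := 2 * (4 / t) ^ q with hρ
  have hρ0 : 0 < ρ := by positivity
  set γ : ℝ := t ^ (q - 1) / D with hγ
  have hγ0 : 0 < γ := by positivity
  have hρpow : κ * ρ ^ (1 - a) = t / (4 * γ) := by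
    have h1 : ρ ^ (1 - a) = 2 ^ (1 - a) * 4 ^ (q - 2) / t ^ (q - 2) := by
      rw [hρ, Real.mul_rpow (by norm_num) (by positivity), ← Real.rpow_mul (by positivity), hqa,
        Real.div_rpow (by norm_num) ht.le]
      ring
    have h2 : t ^ (q - 1) = t * t ^ (q - 2) := by
      rw [← Real.rpow_one_add' ht.le (by linarith)]
      congr 1; ring
    rw [h1, hγ, hD, h2]
    have : t ^ (q - 2) ≠ 0 := by positivity
    field_simp
  set S : Set ℝ := {s | ENNReal.ofReal t < b s} with hS
  have hSm : MeasurableSet S := measurableSet_lt measurable_const hbm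
  have hSle : ∀ s, s ∉ S → φ s ≤ ENNReal.ofReal γ := by
    intro s hs
    have h1 : b s ≤ ENNReal.ofReal t := not_lt.1 hs
    have h2 : ENNReal.ofReal D * φ s ≤ ENNReal.ofReal (t ^ (q - 1)) := by
      have := ENNReal.rpow_le_rpow h1 hq1.le
      rwa [hb, ← ENNReal.rpow_mul, one_div_mul_cancel hq1.ne', ENNReal.rpow_one,
        ENNReal.ofReal_rpow_of_pos ht] at this
    rw [hγ, ENNReal.ofReal_div_of_pos hD0, ENNReal.le_div_iff_mul_le (by left; simpa using hD0)
      (by left; simp), mul_comm]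
    exact h2
  set U : Set ℝ := {τ : ℝ | |τ| < ρ} with hU
  have hUm : MeasurableSet U := measurableSet_lt (by fun_prop) measurable_const
  set kn := U.indicator k with hkn
  set kf := Uᶜ.indicator k with hkf
  have hknm : Measurable kn := hkm.indicator hUm
  have hkfm : Measurable kf := hkm.indicator hUm.compl
  set φb := S.indicator φ with hφb
  set φs := Sᶜ.indicator φ with hφs
  have hφbm : Measurable φb := hφ.indicator hSm
  have hφsm : Measurable φs := hφ.indicator hSm.compl
  have hknint : ∫⁻ τ, kn τ = ENNReal.ofReal (t / (4 * γ)) := by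
    rw [← hρpow]; exact lintegral_rieszKernel_near ha1 hρ0
  have hkfint : ∫⁻ τ, kf τ ^ q = ENNReal.ofReal ((t / 4) ^ q) := by
    rw [hkf, hk, ha, lintegral_rieszKernel_far hq0 hρ0]
    congr 1
    rw [hρ, Real.div_rpow (by norm_num) ht.le, Real.div_rpow ht.le (by norm_num)]
    field_simp
  -- Far kernel against φ is at most t/4 by Hölder; near kernel against values at most γ is at most
  -- t/4 by its mass. Near kernel against large values must reach the remaining t/2, and its L¹ norm
  -- is computed for Chebyshev.
  have hsplit : ∀ x, F x ≤ (∫⁻ s, kf (x - s) * φ s) + (∫⁻ s, kn (x - s) * φs s) +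
      ∫⁻ s, kn (x - s) * φb s := by
    intro x
    rw [← lintegral_add_left (by fun_prop), ← lintegral_add_left (by fun_prop)]
    refine lintegral_mono fun s => ?_
    by_cases h1 : x - s ∈ U <;> by_cases h2 : s ∈ S <;> simp [kf, kn, φs, φb, h1, h2]
  have hF1 : ∀ x, (∫⁻ s, kf (x - s) * φ s) ≤ ENNReal.ofReal (t / 4) := by
    intro x
    have hconj : Real.HolderConjugate q (q / (q - 1)) :=
      Real.HolderConjugate.conjExponent (by linarith)
    have h := ENNReal.lintegral_mul_le_Lp_mul_Lq volume hconj
      (f := fun s => kf (x - s)) (g := φ) (by fun_prop) hφ.aemeasurable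
    refine h.trans ?_
    rw [lintegral_sub_left_eq_self (fun s => kf s ^ q) x, hN, ENNReal.one_rpow, mul_one, hkfint,
      ENNReal.ofReal_rpow_of_nonneg (by positivity) (by positivity),
      ← Real.rpow_mul (by positivity), mul_one_div_cancel hq0.ne', Real.rpow_one]
  have hF2 : ∀ x, (∫⁻ s, kn (x - s) * φs s) ≤ ENNReal.ofReal (t / 4) := by
    intro x
    calc _ ≤ ∫⁻ s, kn (x - s) * ENNReal.ofReal γ := by
          refine lintegral_mono fun s => ?_
          gcongr
          by_cases h2 : s ∈ S
          · simp [φs, h2]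
          · simpa [φs, h2] using hSle s h2
      _ = _ := by
          rw [lintegral_mul_const _ (by fun_prop), lintegral_sub_left_eq_self kn x, hknint,
            ← ENNReal.ofReal_mul (by positivity)]
          congr 1
          field_simp
  have hF3 : ∫⁻ x, ∫⁻ s, kn (x - s) * φb s =
      ENNReal.ofReal (t / (4 * γ)) * ∫⁻ s in S, φ s := by
    rw [lintegral_lintegral_swap (by fun_prop)]
    have : ∀ s, ∫⁻ x, kn (x - s) * φb s = ENNReal.ofReal (t / (4 * γ)) * φb s := by
      intro s
      rw [lintegral_mul_const _ (by fun_prop), lintegral_sub_right_eq_self kn s, hknint]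
    simp_rw [this]
    rw [lintegral_const_mul _ hφbm, hφb, lintegral_indicator hSm]
  have hsub : {x | ENNReal.ofReal t < F x} ⊆
      {x | ENNReal.ofReal (t / 2) ≤ ∫⁻ s, kn (x - s) * φb s} := by
    intro x hx
    have hx : ENNReal.ofReal t < F x := hx
    rw [mem_ofPred_eq]
    by_contra! hlt
    have h1 := (hsplit x).trans (add_le_add (add_le_add (hF1 x) (hF2 x)) hlt.le)
    rw [← ENNReal.ofReal_add (by positivity) (by positivity),
      ← ENNReal.ofReal_add (by positivity) (by positivity),
      show t / 4 + t / 4 + t / 2 = t by ring] at h1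
    exact absurd hx (not_lt.2 h1)
  have hcheb := mul_meas_ge_le_lintegral (μ := volume) (hconvm hknm hφbm) (ENNReal.ofReal (t / 2))
  rw [hF3] at hcheb
  have hconst : ENNReal.ofReal (2 / t) * ENNReal.ofReal (t / (4 * γ)) =
      ENNReal.ofReal (D / 2) * ENNReal.ofReal (t ^ (-(q - 1))) := by
    rw [← ENNReal.ofReal_mul (by positivity), ← ENNReal.ofReal_mul (by positivity)]
    congr 1
    rw [Real.rpow_neg ht.le, hγ]
    field_simp
    norm_num
  have hone : ENNReal.ofReal (2 / t) * ENNReal.ofReal (t / 2) = 1 := by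
    rw [← ENNReal.ofReal_mul (by positivity), ← ENNReal.ofReal_one]
    congr 1
    field_simp
  calc _ ≤ volume {x | ENNReal.ofReal (t / 2) ≤ ∫⁻ s, kn (x - s) * φb s} := measure_mono hsub
    _ = ENNReal.ofReal (2 / t) * (ENNReal.ofReal (t / 2) *
        volume {x | ENNReal.ofReal (t / 2) ≤ ∫⁻ s, kn (x - s) * φb s}) := by
          rw [← mul_assoc, hone, one_mul]
    _ ≤ ENNReal.ofReal (2 / t) * (ENNReal.ofReal (t / (4 * γ)) * ∫⁻ s in S, φ s) := by gcongr
    _ = _ := by rw [← mul_assoc, hconst]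

/-- The diagonal-dual Hardy–Littlewood–Sobolev inequality on the line. -/
theorem exists_rieszKernel_conv_Lp_le {q : ℝ} (hq : 2 < q) :
    ∃ C : ℝ≥0, ∀ φ : ℝ → ℝ≥0∞, Measurable φ →
      (∫⁻ t, (∫⁻ s, rieszKernel (2 / q) (t - s) * φ s) ^ q) ^ (1 / q) ≤
        C * (∫⁻ s, φ s ^ (q / (q - 1))) ^ (1 / (q / (q - 1))) := by
  have hq0 : 0 < q := by linarith
  have hq1 : 0 < q - 1 := by linarith
  set r : ℝ := q / (q - 1) with hr
  have hr0 : 0 < r := by positivity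
  obtain ⟨C, hC⟩ := lintegral_rieszKernel_conv_rpow_le_of_eq_one hq
  -- Adding 1 keeps the constant nonzero, so the right side is ⊤ when N = ⊤.
  refine ⟨C ^ (1 / q) + 1, fun φ hφ => ?_⟩
  set N : ℝ≥0∞ := ∫⁻ s, φ s ^ r with hN
  by_cases hN0 : N = 0
  · have hz : ∀ᵐ s, φ s = 0 := by
      rw [hN, lintegral_eq_zero_iff (hφ.pow_const _)] at hN0
      filter_upwards [hN0] with s hs
      exact (ENNReal.rpow_eq_zero_iff_of_pos hr0).1 hs
    have h1 : ∀ t, ∫⁻ s, rieszKernel (2 / q) (t - s) * φ s = 0 := by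
      intro t
      rw [lintegral_congr_ae (g := fun _ => 0)]
      · simp
      · filter_upwards [hz] with s hs
        simp [hs]
    simp [h1, ENNReal.zero_rpow_of_pos hq0, hq0]
  by_cases hNt : N = ⊤
  · rw [hNt, ENNReal.top_rpow_of_pos (by positivity), ENNReal.mul_top]
    · exact le_top
    · positivity
  set M : ℝ≥0∞ := N ^ (1 / r) with hM
  have hM0 : M ≠ 0 := by
    rw [hM]; simp [ENNReal.rpow_eq_zero_iff, hN0, hNt]
  have hMt : M ≠ ⊤ := ENNReal.rpow_ne_top_of_nonneg (by positivity) hNt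
  have hMr : M ^ r = N := by
    rw [hM, ← ENNReal.rpow_mul, one_div_mul_cancel hr0.ne', ENNReal.rpow_one]
  have hnorm : ∫⁻ s, (M⁻¹ * φ s) ^ r = 1 := by
    simp_rw [ENNReal.mul_rpow_of_nonneg _ _ hr0.le]
    rw [lintegral_const_mul _ (hφ.pow_const _), ENNReal.inv_rpow, hMr, ENNReal.inv_mul_cancel hN0 hNt]
  have h1 := hC (fun s => M⁻¹ * φ s) (hφ.const_mul _) hnorm
  have hkm := measurable_rieszKernel (2 / q)
  have h2 : ∀ t, ∫⁻ s, rieszKernel (2 / q) (t - s) * φ s =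
      M * ∫⁻ s, rieszKernel (2 / q) (t - s) * (M⁻¹ * φ s) := by
    intro t
    rw [← lintegral_const_mul _ (by fun_prop)]
    refine lintegral_congr fun s => ?_
    rw [mul_left_comm, ← mul_assoc M, ENNReal.mul_inv_cancel hM0 hMt, one_mul]
  have hm : Measurable fun t => ∫⁻ s, rieszKernel (2 / q) (t - s) * (M⁻¹ * φ s) := by
    apply Measurable.lintegral_prod_right'
      (f := fun z : ℝ × ℝ => rieszKernel (2 / q) (z.1 - z.2) * (M⁻¹ * φ z.2))
    fun_prop
  have h3 : ∀ t, (∫⁻ s, rieszKernel (2 / q) (t - s) * φ s) ^ q =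
      M ^ q * (∫⁻ s, rieszKernel (2 / q) (t - s) * (M⁻¹ * φ s)) ^ q := fun t => by
    rw [h2, ENNReal.mul_rpow_of_nonneg _ _ hq0.le]
  rw [lintegral_congr h3, lintegral_const_mul _ (hm.pow_const _), ENNReal.mul_rpow_of_nonneg _ _ (by positivity),
    ← ENNReal.rpow_mul, mul_one_div_cancel hq0.ne', ENNReal.rpow_one, mul_comm]
  gcongr
  refine (ENNReal.rpow_le_rpow h1 (by positivity)).trans ?_
  rw [← ENNReal.coe_rpow_of_nonneg _ (by positivity)]
  exact_mod_cast le_self_add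

/-! ### Minkowski's integral inequality -/

/-- Minkowski's integral inequality. -/
theorem lintegral_lintegral_rpow_le {α β : Type*} [MeasurableSpace α] [MeasurableSpace β]
    {μ : Measure α} {ν : Measure β} [SigmaFinite μ] [SFinite ν] {F : α → β → ℝ≥0∞}
    (hF : Measurable (Function.uncurry F)) {p : ℝ} (hp : 1 < p) :
    (∫⁻ x, (∫⁻ s, F x s ∂ν) ^ p ∂μ) ^ (1 / p) ≤ ∫⁻ s, (∫⁻ x, F x s ^ p ∂μ) ^ (1 / p) ∂ν := by
  have hp0 : 0 < p := by linarith
  have hp1 : 0 < p - 1 := by linarith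
  set M := ∫⁻ s, (∫⁻ x, F x s ^ p ∂μ) ^ (1 / p) ∂ν with hM
  set G : α → ℝ≥0∞ := fun x => ∫⁻ s, F x s ∂ν with hG
  have hGm : Measurable G := Measurable.lintegral_prod_right hF
  have hconj : Real.HolderConjugate p (p / (p - 1)) :=
    Real.HolderConjugate.conjExponent hp
  -- Duality: bound one factor of H^p = H·H^{p-1} by G, apply Hölder for each s, and divide by a
  -- power of I. The division requires I finite, whence the truncations H of G.
  have key : ∀ H : α → ℝ≥0∞, Measurable H → (∀ x, H x ≤ G x) → ∫⁻ x, H x ^ p ∂μ ≠ ⊤ →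
      ∫⁻ x, H x ^ p ∂μ ≤ M ^ p := by
    intro H hH hHG hfin
    set I := ∫⁻ x, H x ^ p ∂μ with hI
    by_cases hI0 : I = 0
    · rw [hI0]; exact zero_le
    have h1 : I ≤ M * I ^ (1 / (p / (p - 1))) := by
      calc I ≤ ∫⁻ x, (∫⁻ s, F x s * H x ^ (p - 1) ∂ν) ∂μ := by
            refine lintegral_mono fun x => ?_
            rw [lintegral_mul_const (f := F x) _ (hF.comp measurable_prodMk_left)]
            have : H x ^ p = H x * H x ^ (p - 1) := by
              conv_rhs => rw [← ENNReal.rpow_one (H x), ← ENNReal.rpow_mul, one_mul,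
                ← ENNReal.rpow_add_of_nonneg _ _ zero_le_one hp1.le]
              congr 1; ring
            rw [this]
            gcongr
            exact hHG x
        _ = ∫⁻ s, (∫⁻ x, F x s * H x ^ (p - 1) ∂μ) ∂ν := by
            rw [lintegral_lintegral_swap]
            exact (hF.mul ((hH.comp measurable_fst).pow_const _)).aemeasurable
        _ ≤ ∫⁻ s, (∫⁻ x, F x s ^ p ∂μ) ^ (1 / p) * I ^ (1 / (p / (p - 1))) ∂ν := by
            refine lintegral_mono fun s => ?_
            refine (ENNReal.lintegral_mul_le_Lp_mul_Lq μ hconj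
              (hF.comp measurable_prodMk_right).aemeasurable
              (hH.pow_const _).aemeasurable).trans (le_of_eq ?_)
            congr 2
            refine lintegral_congr fun x => ?_
            rw [← ENNReal.rpow_mul]
            congr 1
            field_simp
        _ = _ := by
            rw [lintegral_mul_const]
            exact (Measurable.lintegral_prod_left (hF.pow_const p)).pow_const _
    have h2 : I = I ^ (1 / p) * I ^ (1 / (p / (p - 1))) := by
      rw [← ENNReal.rpow_add _ _ hI0 hfin]
      have : 1 / p + 1 / (p / (p - 1)) = 1 := by field_simp; ring
      rw [this, ENNReal.rpow_one]
    have h3 : I ^ (1 / p) ≤ M := by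
      conv_lhs at h1 => rw [h2]
      refine (ENNReal.mul_le_mul_iff_left ?_ ?_).1 h1
      · simp [ENNReal.rpow_eq_zero_iff, hI0, hfin]
      · exact ENNReal.rpow_ne_top_of_nonneg (by positivity) hfin
    have := ENNReal.rpow_le_rpow h3 hp0.le
    rwa [← ENNReal.rpow_mul, one_div_mul_cancel hp0.ne', ENNReal.rpow_one] at this
  suffices h : ∫⁻ x, G x ^ p ∂μ ≤ M ^ p by
    have := ENNReal.rpow_le_rpow h (show 0 ≤ 1 / p by positivity)
    rwa [← ENNReal.rpow_mul, mul_one_div_cancel hp0.ne', ENNReal.rpow_one] at this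
  -- Truncation in height and in support makes the p-th power integrable; monotone convergence
  -- recovers G.
  set H : ℕ → α → ℝ≥0∞ := fun n => (spanningSets μ n).indicator fun x => min (G x) n with hH
  have hHm : ∀ n, Measurable (H n) := fun n =>
    (hGm.min measurable_const).indicator (measurableSet_spanningSets μ n)
  have hmono : Monotone H := by
    intro m n hmn x
    simp only [hH]
    refine (indicator_le_indicator_of_subset (monotone_spanningSets μ hmn) (fun _ => zero_le) x).trans ?_
    apply indicator_le_indicator
    gcongr
  have hsup : ∀ x, ⨆ n, H n x ^ p = G x ^ p := by
    intro x
    refine iSup_eq_of_tendsto (fun m n hmn => ENNReal.rpow_le_rpow (hmono hmn x) hp0.le) ?_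
    refine (ENNReal.continuous_rpow_const.tendsto _).comp ?_
    have h1 : Filter.Tendsto (fun n : ℕ => min (G x) (n : ℝ≥0∞)) Filter.atTop (nhds (min (G x) ⊤)) :=
      tendsto_const_nhds.min ENNReal.tendsto_nat_nhds_top
    rw [min_top_right] at h1
    refine h1.congr' ?_
    obtain ⟨n₀, hn₀⟩ : ∃ n, x ∈ spanningSets μ n := by
      exact mem_iUnion.1 (iUnion_spanningSets μ ▸ mem_univ x)
    filter_upwards [Filter.eventually_ge_atTop n₀] with n hn
    simp only [hH]
    rw [indicator_of_mem (monotone_spanningSets μ hn hn₀)]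
  simp_rw [← hsup]
  rw [lintegral_iSup (fun n => (hHm n).pow_const _)
    (fun m n hmn x => ENNReal.rpow_le_rpow (hmono hmn x) hp0.le)]
  refine iSup_le fun n => key (H n) (hHm n) (fun x => ?_) ?_
  · exact indicator_le' (fun x _ => min_le_left _ _) (fun x _ => zero_le) x
  · refine ne_top_of_le_ne_top (b := (n : ℝ≥0∞) ^ p * μ (spanningSets μ n)) ?_ ?_
    · exact ENNReal.mul_ne_top (ENNReal.rpow_ne_top_of_nonneg hp0.le (by simp))
        (measure_spanningSets_lt_top μ n).ne
    · rw [← lintegral_indicator_const (measurableSet_spanningSets μ n)]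
      refine lintegral_mono fun x => ?_
      by_cases hx : x ∈ spanningSets μ n
      · simp only [hH, indicator_of_mem hx]
        exact ENNReal.rpow_le_rpow (min_le_right _ _) hp0.le
      · simp [hH, hx, ENNReal.zero_rpow_of_pos hp0]

/-! ### Plancherel on L¹ ∩ L² and Fourier multipliers -/

theorem fourierInv_real_eq (g : ℝ → ℂ) (x : ℝ) :
    𝓕⁻ g x = ∫ ξ : ℝ, Complex.exp (2 * Real.pi * Complex.I * (x * ξ)) * g ξ := by
  rw [Real.fourierInv_eq']
  refine integral_congr_ae (Filter.Eventually.of_forall fun ξ => ?_)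
  simp only [smul_eq_mul, RCLike.inner_apply, conj_trivial]
  congr 2
  push_cast
  ring

theorem fourier_real_eq_exp (g : ℝ → ℂ) (x : ℝ) :
    𝓕 g x = ∫ ξ : ℝ, Complex.exp (-(2 * Real.pi * Complex.I * (x * ξ))) * g ξ := by
  rw [Real.fourier_eq']
  refine integral_congr_ae (Filter.Eventually.of_forall fun ξ => ?_)
  simp only [smul_eq_mul, RCLike.inner_apply, conj_trivial]
  congr 2
  push_cast
  ring

theorem continuous_fourier_of_integrable {φ : ℝ → ℂ} (hφ : Integrable φ) : Continuous (𝓕 φ) :=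
  VectorFourier.fourierIntegral_continuous Real.continuous_fourierChar
    (innerSL ℝ).continuous₂ hφ

theorem integral_fourier_mul_eq {φ ψ : ℝ → ℂ} (hφ : Integrable φ) (hψ : Integrable ψ) :
    ∫ ξ, 𝓕 φ ξ * ψ ξ = ∫ x, φ x * 𝓕 ψ x := by
  simpa using! VectorFourier.integral_fourierIntegral_smul_eq_flip (L := innerₗ ℝ)
    Real.continuous_fourierChar continuous_inner hφ hψ

/-- The `L²` Fourier transform is given by the Fourier integral on `L¹ ∩ L²`. -/
theorem fourier_toLp_ae_eq {φ : ℝ → ℂ} (h1 : MemLp φ 1) (h2 : MemLp φ 2) :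
    (𝓕 (h2.toLp φ) : Lp ℂ 2 (volume : Measure ℝ)) =ᵐ[volume] 𝓕 φ := by
  have hφ : Integrable φ := memLp_one_iff_integrable.1 h1
  -- Both sides are locally integrable, so testing against smooth compactly supported functions
  -- suffices. On the L² side the transform moves to the test function by the distributional
  -- definition, on the other by the multiplication formula.
  apply ae_eq_of_integral_contDiff_smul_eq
  · exact (Lp.memLp _).locallyIntegrable (by norm_num)
  · exact (continuous_fourier_of_integrable hφ).locallyIntegrable
  intro g hg hgs
  have hgc : HasCompactSupport (fun x => (g x : ℂ)) := hgs.comp_left Complex.ofReal_zero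
  have hgd : ContDiff ℝ ∞ (fun x => (g x : ℂ)) := Complex.ofRealCLM.contDiff.comp hg
  set G : SchwartzMap ℝ ℂ := hgc.toSchwartzMap hgd with hG
  have h := Lp.fourier_toTemperedDistribution_eq (h2.toLp φ)
  have h' := congrArg (fun T => T G) h
  simp only [TemperedDistribution.fourier_apply, Lp.toTemperedDistribution_apply] at h'
  have hl : ∫ x, g x • (𝓕 (h2.toLp φ) : Lp ℂ 2 (volume : Measure ℝ)) x =
      ∫ x, G x • (𝓕 (h2.toLp φ) : Lp ℂ 2 (volume : Measure ℝ)) x := by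
    congr 1 with x
  rw [hl, ← h']
  have hm : ∫ x, (𝓕 G) x • (h2.toLp φ) x = ∫ x, 𝓕 (G : ℝ → ℂ) x * φ x := by
    refine integral_congr_ae ?_
    filter_upwards [h2.coeFn_toLp] with x hx
    rw [hx, smul_eq_mul, SchwartzMap.fourier_coe]
  rw [hm, integral_fourier_mul_eq G.integrable hφ]
  congr 1 with x

/-- Plancherel's identity on `L¹ ∩ L²`. -/
theorem lintegral_enorm_fourier_sq {φ : ℝ → ℂ} (h1 : MemLp φ 1) (h2 : MemLp φ 2) :
    ∫⁻ ξ, ‖𝓕 φ ξ‖ₑ ^ 2 = ∫⁻ x, ‖φ x‖ₑ ^ 2 := by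
  have hn : eLpNorm (𝓕 φ) 2 volume = eLpNorm φ 2 volume := by
    rw [← eLpNorm_congr_ae (fourier_toLp_ae_eq h1 h2), ← eLpNorm_congr_ae h2.coeFn_toLp,
      ← Lp.enorm_def, ← Lp.enorm_def, ← ofReal_norm, ← ofReal_norm, Lp.norm_fourier_eq]
  have hsq : ∀ f : ℝ → ℂ, ∫⁻ x, ‖f x‖ₑ ^ 2 = eLpNorm f 2 volume ^ 2 := by
    intro f
    rw [eLpNorm_eq_lintegral_rpow_enorm_toReal (by norm_num) (by norm_num), ← ENNReal.rpow_natCast,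
      ← ENNReal.rpow_mul]
    simp
  rw [hsq, hsq, hn]

theorem lintegral_enorm_fourierInv_sq {φ : ℝ → ℂ} (h1 : MemLp φ 1) (h2 : MemLp φ 2) :
    ∫⁻ ξ, ‖𝓕⁻ φ ξ‖ₑ ^ 2 = ∫⁻ x, ‖φ x‖ₑ ^ 2 := by
  rw [← lintegral_enorm_fourier_sq h1 h2, ← lintegral_neg_eq_self (fun ξ => ‖𝓕 φ ξ‖ₑ ^ 2)]
  simp_rw [Real.fourierInv_eq_fourier_neg]

/-- The Fourier multiplier operator with symbol `m`. -/
noncomputable def fourierMult (m φ : ℝ → ℂ) (x : ℝ) : ℂ :=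
  ∫ ξ : ℝ, Complex.exp (2 * Real.pi * Complex.I * (x * ξ)) * (m ξ * 𝓕 φ ξ)

theorem fourierMult_eq_fourierInv (m φ : ℝ → ℂ) : fourierMult m φ = 𝓕⁻ fun ξ => m ξ * 𝓕 φ ξ := by
  ext x
  rw [fourierInv_real_eq, fourierMult]

theorem integrable_symbol_mul_fourier {m φ : ℝ → ℂ} (hm : Integrable m) (hφ : Integrable φ) :
    Integrable fun ξ => m ξ * 𝓕 φ ξ := by
  refine hm.mul_bdd (c := ∫ x, ‖φ x‖) (continuous_fourier_of_integrable hφ).aestronglyMeasurable ?_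
  exact Filter.Eventually.of_forall fun ξ => VectorFourier.norm_fourierIntegral_le_integral_norm _ _ _ _ _

theorem continuous_fourierMult {m φ : ℝ → ℂ} (hm : Integrable m) (hφ : Integrable φ) :
    Continuous (fourierMult m φ) := by
  rw [fourierMult_eq_fourierInv, Real.fourierInv_eq_fourier_comp_neg]
  exact continuous_fourier_of_integrable (integrable_symbol_mul_fourier hm hφ).comp_neg

theorem integrable_cexp_mul {m : ℝ → ℂ} (hm : Integrable m) (x : ℝ) :
    Integrable fun ξ : ℝ => Complex.exp (2 * Real.pi * Complex.I * (x * ξ)) * m ξ := by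
  refine hm.bdd_mul (c := 1) (by fun_prop) (Filter.Eventually.of_forall fun ξ => ?_)
  have : (2 * Real.pi * Complex.I * (x * ξ) : ℂ) = ((2 * Real.pi * (x * ξ) : ℝ) : ℂ) * Complex.I := by
    push_cast; ring
  rw [this, Complex.norm_exp_ofReal_mul_I]

theorem fourierMult_add {m φ ψ : ℝ → ℂ} (hm : Integrable m) (hφ : Integrable φ)
    (hψ : Integrable ψ) : fourierMult m (φ + ψ) = fourierMult m φ + fourierMult m ψ := by
  ext x
  rw [Pi.add_apply, fourierMult, fourierMult, fourierMult, ← integral_add]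
  · congr 1 with ξ
    have : 𝓕 (φ + ψ) ξ = 𝓕 φ ξ + 𝓕 ψ ξ := by
      rw [Real.fourier_eq, Real.fourier_eq, Real.fourier_eq, ← integral_add]
      · simp
      · exact (Real.fourierIntegral_convergent_iff ξ).2 hφ
      · exact (Real.fourierIntegral_convergent_iff ξ).2 hψ
    rw [this]
    ring
  · exact integrable_cexp_mul (integrable_symbol_mul_fourier hm hφ) x
  · exact integrable_cexp_mul (integrable_symbol_mul_fourier hm hψ) x

/-- Moving the transform from φ to the symbol shows the operator to be convolution with the inverse
transform of m, whose supremum bounds the L¹ → L^∞ norm. -/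
theorem enorm_fourierMult_le {m φ : ℝ → ℂ} (hm : Integrable m) (hφ : Integrable φ) {A : ℝ≥0}
    (hA : ∀ x : ℝ, ‖∫ ξ : ℝ, Complex.exp (2 * Real.pi * Complex.I * (x * ξ)) * m ξ‖ ≤ A) (x : ℝ) :
    ‖fourierMult m φ x‖ₑ ≤ A * ∫⁻ y, ‖φ y‖ₑ := by
  have h1 : fourierMult m φ x = ∫ y, φ y *
      𝓕 (fun ξ : ℝ => Complex.exp (2 * Real.pi * Complex.I * (x * ξ)) * m ξ) y := by
    rw [← integral_fourier_mul_eq hφ (integrable_cexp_mul hm x), fourierMult]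
    congr 1 with ξ
    ring
  rw [h1]
  refine (enorm_integral_le_lintegral_enorm _).trans ?_
  rw [← lintegral_const_mul' _ _ (by simp)]
  refine lintegral_mono fun y => ?_
  rw [enorm_mul, mul_comm]
  gcongr
  rw [fourier_real_eq_exp]
  have h2 := hA (x - y)
  have h3 : ∫ ξ : ℝ, Complex.exp (-(2 * Real.pi * Complex.I * (y * ξ))) *
      (Complex.exp (2 * Real.pi * Complex.I * (x * ξ)) * m ξ) =
      ∫ ξ : ℝ, Complex.exp (2 * Real.pi * Complex.I * ((x - y : ℝ) * ξ)) * m ξ := by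
    congr 1 with ξ
    rw [← mul_assoc, ← Complex.exp_add]
    congr 2
    push_cast
    ring
  rw [h3, ← ofReal_norm, ← ENNReal.ofReal_coe_nnreal]
  exact ENNReal.ofReal_le_ofReal h2

theorem lintegral_enorm_fourierMult_sq_le {m φ : ℝ → ℂ} (hm : Integrable m)
    (hm1 : ∀ ξ, ‖m ξ‖ ≤ 1) (h1 : MemLp φ 1) (h2 : MemLp φ 2) :
    ∫⁻ x, ‖fourierMult m φ x‖ₑ ^ 2 ≤ ∫⁻ x, ‖φ x‖ₑ ^ 2 := by
  have hφ : Integrable φ := memLp_one_iff_integrable.1 h1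
  have hint := integrable_symbol_mul_fourier hm hφ
  have hle : ∀ ξ, ‖m ξ * 𝓕 φ ξ‖ ≤ ‖𝓕 φ ξ‖ := by
    intro ξ
    rw [norm_mul]
    exact mul_le_of_le_one_left (norm_nonneg _) (hm1 ξ)
  have hF2 : MemLp (𝓕 φ) 2 := (memLp_congr_ae (fourier_toLp_ae_eq h1 h2)).1 (Lp.memLp _)
  have hG2 : MemLp (fun ξ => m ξ * 𝓕 φ ξ) 2 :=
    hF2.mono hint.aestronglyMeasurable (Filter.Eventually.of_forall hle)
  rw [fourierMult_eq_fourierInv,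
    lintegral_enorm_fourierInv_sq (memLp_one_iff_integrable.2 hint) hG2,
    ← lintegral_enorm_fourier_sq h1 h2]
  refine lintegral_mono fun ξ => ?_
  have := hle ξ
  simp only [← ofReal_norm]
  gcongr

/-! ### Dispersive estimates for the truncated propagator -/

/-- The truncated fundamental solution operator of `∂_t + (∂_x - l)^n` at time `τ`. -/
noncomputable def propagator (n : ℕ) (l R τ : ℝ) : (ℝ → ℂ) → ℝ → ℂ :=
  fourierMult (propagatorSymbol n l R τ)

theorem enorm_propagator_le {n : ℕ} (hn : 2 ≤ n) (l : ℝ) {R τ : ℝ} (hR : 0 ≤ R) (hτ : τ ≠ 0)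
    {φ : ℝ → ℂ} (hφ : Integrable φ) (x : ℝ) :
    ‖propagator n l R τ φ x‖ₑ ≤
      ((3 * n * (n + 1) : ℝ≥0) * (‖τ‖₊ ^ (-(1 / n : ℝ)) : ℝ≥0) : ℝ≥0) * ∫⁻ y, ‖φ y‖ₑ := by
  refine enorm_fourierMult_le (integrable_propagatorSymbol n l R τ) hφ (fun x => ?_) x
  refine (norm_fourierInv_propagatorSymbol_le hn l hR hτ x).trans (le_of_eq ?_)
  push_cast
  rw [Real.norm_eq_abs]

theorem exists_conj_toReal {p p' : ℝ≥0∞} (hp : 2 < p) (hpt : p ≠ ⊤) (hpp' : 1 / p + 1 / p' = 1) :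
    p' = ENNReal.ofReal (p.toReal / (p.toReal - 1)) := by
  set r := p.toReal with hr
  have hr2 : 2 < r := by
    have := (ENNReal.toReal_lt_toReal (by norm_num) hpt).2 hp
    simpa using this
  have hpe : p = ENNReal.ofReal r := (ENNReal.ofReal_toReal hpt).symm
  have h1 : 1 / p = ENNReal.ofReal (1 / r) := by
    rw [hpe, ENNReal.ofReal_div_of_pos (by linarith), ENNReal.ofReal_one]
  have h2 : ENNReal.ofReal (1 / r) + ENNReal.ofReal (1 - 1 / r) = 1 := by
    rw [← ENNReal.ofReal_add (by positivity), add_sub_cancel, ENNReal.ofReal_one]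
    rw [sub_nonneg, div_le_one (by linarith)]; linarith
  rw [h1] at hpp'
  replace hpp' := hpp'.trans h2.symm
  have h3 : p'⁻¹ = ENNReal.ofReal (1 - 1 / r) := by
    rw [← one_div]
    exact (ENNReal.add_right_inj (by simp)).1 hpp'
  rw [← inv_inv p', h3, ← ENNReal.ofReal_inv_of_pos]
  · congr 1
    have : r - 1 ≠ 0 := by linarith
    have : r ≠ 0 := by linarith
    field_simp
  · rw [sub_pos, div_lt_one (by linarith)]; linarith

theorem eLpNorm_ofReal_eq {r : ℝ} (hr : 0 < r) (φ : ℝ → ℂ) :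
    eLpNorm φ (ENNReal.ofReal r) volume = (∫⁻ x, ‖φ x‖ₑ ^ r) ^ (1 / r) := by
  rw [eLpNorm_eq_lintegral_rpow_enorm_toReal (by simpa using hr) (by simp),
    ENNReal.toReal_ofReal hr.le]

/-- The dispersive `L^{p'} → L^p` estimate, uniformly in the weight and the truncation. -/
theorem exists_eLpNorm_propagator_le {n : ℕ} (hn : 2 ≤ n) {p p' : ℝ≥0∞} (hp : 2 ≤ p)
    (hpp' : 1 / p + 1 / p' = 1) :
    ∃ C : ℝ≥0, ∀ (l R τ : ℝ), 0 ≤ R → τ ≠ 0 → ∀ φ : ℝ → ℂ, Measurable φ → MemLp φ 1 → MemLp φ 2 →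
      eLpNorm (propagator n l R τ φ) p volume ≤
        C * (rieszKernel ((1 - 2 * (p⁻¹).toReal) / n) τ * eLpNorm φ p' volume) := by
  set C₀ : ℝ≥0 := 3 * n * (n + 1) with hC₀
  have hC₀0 : C₀ ≠ 0 := by
    have : n ≠ 0 := by omega
    simp [hC₀, this]
  -- The endpoints p = ∞ and p = 2 are the two input bounds themselves; the interpolation covers
  -- only 2 < p < ∞.
  by_cases hpt : p = ⊤
  · subst hpt
    have hp1 : p' = 1 := by
      simp at hpp'; exact hpp'
    subst hp1
    refine ⟨C₀, fun l R τ hR hτ φ hφm h1 h2 => ?_⟩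
    rw [eLpNorm_exponent_top, eLpNorm_one_eq_lintegral_enorm]
    refine essSup_le_of_ae_le _ (Filter.Eventually.of_forall fun x => ?_)
    refine (enorm_propagator_le hn l hR hτ (memLp_one_iff_integrable.1 h1) x).trans (le_of_eq ?_)
    rw [← mul_assoc, rieszKernel, ENNReal.coe_mul]
    congr 2
    rw [← ENNReal.ofReal_coe_nnreal]
    congr 1
    push_cast
    simp
  rcases hp.eq_or_lt with rfl | hp2
  · have hp1 : p' = 2 := by
      rw [one_div, one_div] at hpp'
      have h3 : (2 : ℝ≥0∞)⁻¹ + p'⁻¹ = 2⁻¹ + 2⁻¹ := by rw [hpp', ENNReal.inv_two_add_inv_two]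
      have := (ENNReal.add_right_inj (by simp)).1 h3
      exact inv_injective this
    subst hp1
    refine ⟨1, fun l R τ hR hτ φ hφm h1 h2 => ?_⟩
    have h3 := lintegral_enorm_fourierMult_sq_le (integrable_propagatorSymbol n l R τ)
      (norm_propagatorSymbol_le n l R τ) h1 h2
    have h4 : rieszKernel ((1 - 2 * ((2 : ℝ≥0∞)⁻¹).toReal) / n) τ = 1 := by
      simp [rieszKernel]
    rw [h4, ENNReal.coe_one, one_mul, one_mul,
      eLpNorm_eq_lintegral_rpow_enorm_toReal (by norm_num) (by norm_num),
      eLpNorm_eq_lintegral_rpow_enorm_toReal (by norm_num) (by norm_num)]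
    refine ENNReal.rpow_le_rpow ?_ (by positivity)
    simpa [propagator] using h3
  · have hp'e := exists_conj_toReal hp2 hpt hpp'
    set r := p.toReal with hr
    have hr2 : 2 < r := by
      have := (ENNReal.toReal_lt_toReal (by norm_num) hpt).2 hp2
      simpa using this
    have hr0 : 0 < r := by linarith
    have hr1 : 0 < r - 1 := by linarith
    have hpe : p = ENNReal.ofReal r := (ENNReal.ofReal_toReal hpt).symm
    set K : ℝ≥0∞ := ENNReal.ofReal (r / (r - 2)) * 4 * 2 ^ (r - 2) with hK
    have hKt : K ≠ ⊤ := by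
      refine ENNReal.mul_ne_top (ENNReal.mul_ne_top (by simp) (by simp)) ?_
      exact ENNReal.rpow_ne_top_of_nonneg (by linarith) (by simp)
    have hKr : K ^ (1 / r) * (C₀ : ℝ≥0∞) ^ ((r - 2) / r) ≠ ⊤ := by
      refine ENNReal.mul_ne_top (ENNReal.rpow_ne_top_of_nonneg (by positivity) hKt) ?_
      exact ENNReal.rpow_ne_top_of_nonneg (div_nonneg (by linarith) hr0.le) (by simp)
    refine ⟨(K ^ (1 / r) * (C₀ : ℝ≥0∞) ^ ((r - 2) / r)).toNNReal,
      fun l R τ hR hτ φ hφm h1 h2 => ?_⟩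
    rw [ENNReal.coe_toNNReal hKr]
    set B : ℝ≥0 := ‖τ‖₊ ^ (-(1 / n : ℝ)) with hB
    have hB0 : B ≠ 0 := by
      have : ‖τ‖₊ ≠ 0 := by simpa using hτ
      simp [hB, NNReal.rpow_eq_zero_iff, this]
    have hmi := integrable_propagatorSymbol n l R τ
    have main := lintegral_enorm_rpow_le_of_L1_Linfty_of_L2 hr2 (A := C₀ * B)
      (T := propagator n l R τ) (mul_ne_zero hC₀0 hB0)
      (fun φ h1 _ => (continuous_fourierMult hmi (memLp_one_iff_integrable.1 h1)).measurable)
      (fun φ ψ h1 _ h2 _ => fourierMult_add hmi (memLp_one_iff_integrable.1 h1)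
        (memLp_one_iff_integrable.1 h2))
      (fun φ h1 _ x => enorm_propagator_le hn l hR hτ (memLp_one_iff_integrable.1 h1) x)
      (fun φ h1 h2 => lintegral_enorm_fourierMult_sq_le hmi (norm_propagatorSymbol_le n l R τ) h1 h2)
      hφm h1 h2
    -- Interpolation leaves the power (r-2)/r = 1 - 2/p of |τ|^{-1/n}.
    have hrk : rieszKernel ((1 - 2 * (p⁻¹).toReal) / n) τ = (B : ℝ≥0∞) ^ ((r - 2) / r) := by
      rw [rieszKernel, ENNReal.toReal_inv, ← hr, ← ENNReal.coe_rpow_of_nonneg _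
        (div_nonneg (by linarith) hr0.le), ← ENNReal.ofReal_coe_nnreal]
      congr 1
      rw [hB]
      push_cast
      rw [Real.norm_eq_abs, ← Real.rpow_mul (abs_nonneg _)]
      congr 1
      field_simp
    rw [hrk, hp'e, hpe, eLpNorm_ofReal_eq hr0, eLpNorm_ofReal_eq (by positivity)]
    rw [← hK] at main
    clear_value K
    refine (ENNReal.rpow_le_rpow main (by positivity)).trans (le_of_eq ?_)
    have e1 : (0 : ℝ) ≤ 1 / r := by positivity
    rw [ENNReal.mul_rpow_of_nonneg _ _ e1, ENNReal.mul_rpow_of_nonneg _ _ e1, ← ENNReal.rpow_mul,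
      ← ENNReal.rpow_mul, ENNReal.coe_mul, mul_one_div, mul_one_div,
      ENNReal.mul_rpow_of_nonneg _ _ (div_nonneg (by linarith) hr0.le), one_div_div]
    ring

/-! ### Smooth compactly supported functions on the plane -/

/-- The directional derivative of a function on the plane. -/
noncomputable def planeDeriv (v : ℝ × ℝ) (f : ℝ × ℝ → ℂ) : ℝ × ℝ → ℂ := fun z => fderiv ℝ f z v

theorem ContDiff.planeDeriv {f : ℝ × ℝ → ℂ} (hf : ContDiff ℝ ∞ f) (v : ℝ × ℝ) :
    ContDiff ℝ ∞ (planeDeriv v f) :=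
  (hf.fderiv_right (m := ∞) (by simp)).clm_apply contDiff_const

theorem HasCompactSupport.planeDeriv {f : ℝ × ℝ → ℂ} (hf : HasCompactSupport f) (v : ℝ × ℝ) :
    HasCompactSupport (planeDeriv v f) :=
  hf.fderiv_apply ℝ v

theorem hasDerivAt_fst_of_contDiff {f : ℝ × ℝ → ℂ} (hf : ContDiff ℝ ∞ f) (x t : ℝ) :
    HasDerivAt (fun x => f (x, t)) (planeDeriv (1, 0) f (x, t)) x := by
  have h1 := ((hf.differentiable (by simp)) (x, t)).hasFDerivAt
  have h2 : HasDerivAt (fun x : ℝ => (x, t)) (1, 0) x :=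
    (hasDerivAt_id' x).prodMk (hasDerivAt_const x t)
  exact h1.comp_hasDerivAt x h2

theorem hasDerivAt_snd_of_contDiff {f : ℝ × ℝ → ℂ} (hf : ContDiff ℝ ∞ f) (x t : ℝ) :
    HasDerivAt (fun t => f (x, t)) (planeDeriv (0, 1) f (x, t)) t := by
  have h1 := ((hf.differentiable (by simp)) (x, t)).hasFDerivAt
  have h2 : HasDerivAt (fun t : ℝ => (x, t)) (0, 1) t :=
    (hasDerivAt_const t x).prodMk (hasDerivAt_id' t)
  exact h1.comp_hasDerivAt t h2

theorem contDiff_iterate_planeDeriv {f : ℝ × ℝ → ℂ} (hf : ContDiff ℝ ∞ f) (v : ℝ × ℝ) (n : ℕ) :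
    ContDiff ℝ ∞ ((planeDeriv v)^[n] f) := by
  induction n with
  | zero => exact hf
  | succ n ih => rw [Function.iterate_succ_apply']; exact ih.planeDeriv v

theorem hasCompactSupport_iterate_planeDeriv {f : ℝ × ℝ → ℂ} (hf : HasCompactSupport f)
    (v : ℝ × ℝ) (n : ℕ) : HasCompactSupport ((planeDeriv v)^[n] f) := by
  induction n with
  | zero => exact hf
  | succ n ih => rw [Function.iterate_succ_apply']; exact ih.planeDeriv v

theorem iteratedDeriv_fst_eq {f : ℝ × ℝ → ℂ} (hf : ContDiff ℝ ∞ f) (n : ℕ) (t : ℝ) :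
    iteratedDeriv n (fun x => f (x, t)) = fun x => (planeDeriv (1, 0))^[n] f (x, t) := by
  induction n with
  | zero => simp
  | succ n ih =>
    rw [iteratedDeriv_succ, ih, Function.iterate_succ_apply']
    ext x
    exact (hasDerivAt_fst_of_contDiff (contDiff_iterate_planeDeriv hf (1, 0) n) x t).deriv

theorem dispersiveOp_eq {f : ℝ × ℝ → ℂ} (hf : ContDiff ℝ ∞ f) (n : ℕ) :
    dispersiveOp n f = planeDeriv (0, 1) f + (planeDeriv (1, 0))^[n] f := by
  ext ⟨x, t⟩
  simp only [dispersiveOp, Pi.add_apply, iteratedDeriv_fst_eq hf]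
  rw [(hasDerivAt_snd_of_contDiff hf x t).deriv]

theorem contDiff_dispersiveOp {f : ℝ × ℝ → ℂ} (hf : ContDiff ℝ ∞ f) (n : ℕ) :
    ContDiff ℝ ∞ (dispersiveOp n f) := by
  rw [dispersiveOp_eq hf]
  exact (hf.planeDeriv _).add (contDiff_iterate_planeDeriv hf _ n)

theorem hasCompactSupport_dispersiveOp {f : ℝ × ℝ → ℂ} (hf : ContDiff ℝ ∞ f)
    (hc : HasCompactSupport f) (n : ℕ) : HasCompactSupport (dispersiveOp n f) := by
  rw [dispersiveOp_eq hf]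
  exact (hc.planeDeriv _).add (hasCompactSupport_iterate_planeDeriv hc _ n)

theorem exists_bound_and_box {F : ℝ × ℝ → ℂ} (hF : Continuous F) (hc : HasCompactSupport F) :
    ∃ M ρ : ℝ, 0 ≤ M ∧ 0 ≤ ρ ∧ (∀ z, ‖F z‖ ≤ M) ∧ ∀ x t, F (x, t) ≠ 0 → |x| ≤ ρ ∧ |t| ≤ ρ := by
  obtain ⟨M, hM⟩ := hc.exists_bound_of_continuous hF
  obtain ⟨ρ, hρ⟩ := hc.isCompact.isBounded.exists_norm_le
  refine ⟨M, max ρ 0, (norm_nonneg _).trans (hM 0), le_max_right _ _, hM, fun x t h => ?_⟩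
  have h1 := hρ (x, t) (subset_tsupport _ h)
  have h2 := (norm_fst_le (x, t)).trans h1
  have h3 := (norm_snd_le (x, t)).trans h1
  exact ⟨h2.trans (le_max_left _ _), h3.trans (le_max_left _ _)⟩

theorem hasCompactSupport_fst {F : ℝ × ℝ → ℂ} (hF : Continuous F) (hc : HasCompactSupport F)
    (t : ℝ) : HasCompactSupport fun x => F (x, t) := by
  obtain ⟨M, ρ, -, -, -, h⟩ := exists_bound_and_box hF hc
  refine HasCompactSupport.of_support_subset_isCompact (isCompact_Icc (a := -ρ) (b := ρ)) ?_
  intro x hx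
  exact abs_le.1 (h x t hx).1

/-! ### The weighted transform and the equation at fixed frequency -/

/-- The weighted Fourier transform in `x` of `F(·, t)`. -/
noncomputable def waveTransform (l : ℝ) (F : ℝ × ℝ → ℂ) (t ξ : ℝ) : ℂ :=
  ∫ x : ℝ, Complex.exp (-(waveSymbol l ξ * x)) * F (x, t)

theorem cexp_neg_waveSymbol (l ξ x : ℝ) : Complex.exp (-(waveSymbol l ξ * x)) =
    Complex.exp (-(2 * Real.pi * Complex.I * (ξ * x))) * (Real.exp (l * x) : ℂ) := by
  rw [Complex.ofReal_exp, ← Complex.exp_add, waveSymbol]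
  congr 1
  push_cast
  ring

theorem norm_cexp_neg_waveSymbol (l ξ x : ℝ) :
    ‖Complex.exp (-(waveSymbol l ξ * x))‖ = Real.exp (l * x) := by
  rw [Complex.norm_exp]
  congr 1
  simp [waveSymbol]

/-- The weight is absorbed into the exponential, so derivatives can fall on the unweighted function
and become powers of `waveSymbol`. -/
theorem fourier_expWeight (l : ℝ) (F : ℝ × ℝ → ℂ) (t ξ : ℝ) :
    𝓕 (fun x => expWeight l F (x, t)) ξ = waveTransform l F t ξ := by
  rw [fourier_real_eq_exp, waveTransform]
  congr 1 with x
  rw [cexp_neg_waveSymbol]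
  simp only [expWeight]
  ring

theorem integrable_cexp_mul_fst {F : ℝ × ℝ → ℂ} (hF : Continuous F) (hc : HasCompactSupport F)
    (w : ℂ) (t : ℝ) : Integrable fun x : ℝ => Complex.exp (-(w * x)) * F (x, t) := by
  apply Continuous.integrable_of_hasCompactSupport (by fun_prop)
  exact (hasCompactSupport_fst hF hc t).mul_left

theorem waveTransform_planeDeriv_fst {F : ℝ × ℝ → ℂ} (hF : ContDiff ℝ ∞ F)
    (hc : HasCompactSupport F) (l t ξ : ℝ) :
    waveTransform l (planeDeriv (1, 0) F) t ξ = waveSymbol l ξ * waveTransform l F t ξ := by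
  have hu : ∀ x : ℝ, HasDerivAt (fun x : ℝ => Complex.exp (-(waveSymbol l ξ * x)))
      (-(waveSymbol l ξ) * Complex.exp (-(waveSymbol l ξ * x))) x := by
    intro x
    have h1 : HasDerivAt (fun x : ℝ => -(waveSymbol l ξ * (x : ℂ))) (-(waveSymbol l ξ)) x := by
      simpa using (((hasDerivAt_id' x).ofReal_comp).const_mul (waveSymbol l ξ)).fun_neg
    rw [mul_comm]
    exact h1.cexp
  have hi := integrable_cexp_mul_fst hF.continuous hc (waveSymbol l ξ) t
  have := integral_mul_deriv_eq_deriv_mul_of_integrable (fun x _ => hu x)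
    (fun x _ => hasDerivAt_fst_of_contDiff hF x t)
    (integrable_cexp_mul_fst (hF.planeDeriv (1, 0)).continuous (hc.planeDeriv (1, 0))
      (waveSymbol l ξ) t)
    (by
      refine (hi.const_mul (-(waveSymbol l ξ))).congr (Filter.Eventually.of_forall fun x => ?_)
      simp only [Pi.mul_apply]
      ring)
    hi
  rw [waveTransform, this, waveTransform, ← integral_const_mul, ← integral_neg]
  congr 1 with x
  ring

theorem waveTransform_iterate {F : ℝ × ℝ → ℂ} (hF : ContDiff ℝ ∞ F)
    (hc : HasCompactSupport F) (l t ξ : ℝ) (n : ℕ) :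
    waveTransform l ((planeDeriv (1, 0))^[n] F) t ξ = waveSymbol l ξ ^ n * waveTransform l F t ξ := by
  induction n with
  | zero => simp
  | succ n ih =>
    rw [Function.iterate_succ_apply', waveTransform_planeDeriv_fst
      (contDiff_iterate_planeDeriv hF _ n) (hasCompactSupport_iterate_planeDeriv hc _ n), ih]
    ring

theorem hasDerivAt_waveTransform {F : ℝ × ℝ → ℂ} (hF : ContDiff ℝ ∞ F)
    (hc : HasCompactSupport F) (l t ξ : ℝ) :
    HasDerivAt (fun t => waveTransform l F t ξ) (waveTransform l (planeDeriv (0, 1) F) t ξ) t := by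
  have hFc := hF.continuous
  have hD := (hF.planeDeriv (0, 1)).continuous
  obtain ⟨M, ρ, hM, hρ, hb, hs⟩ := exists_bound_and_box hD (hc.planeDeriv (0, 1))
  refine (hasDerivAt_integral_of_dominated_loc_of_deriv_le (s := univ)
    (bound := (Icc (-ρ) ρ).indicator fun x => Real.exp (l * x) * M)
    (F := fun t x => Complex.exp (-(waveSymbol l ξ * x)) * F (x, t))
    (F' := fun t x => Complex.exp (-(waveSymbol l ξ * x)) * planeDeriv (0, 1) F (x, t))
    Filter.univ_mem ?_ ?_ ?_ ?_ ?_ ?_).2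
  · exact Filter.Eventually.of_forall fun t => Continuous.aestronglyMeasurable (by fun_prop)
  · exact integrable_cexp_mul_fst hFc hc _ t
  · exact Continuous.aestronglyMeasurable (by fun_prop)
  · refine Filter.Eventually.of_forall fun x t _ => ?_
    by_cases h : planeDeriv (0, 1) F (x, t) = 0
    · rw [h, mul_zero, norm_zero]
      exact indicator_nonneg (fun x _ => by positivity) x
    · rw [indicator_of_mem (show x ∈ Icc (-ρ) ρ from abs_le.1 (hs x t h).1), norm_mul, norm_cexp_neg_waveSymbol]
      gcongr
      exact hb _
  · apply IntegrableOn.integrable_indicator _ measurableSet_Icc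
    exact (Continuous.continuousOn (by fun_prop)).integrableOn_Icc
  · exact Filter.Eventually.of_forall fun x t _ => (hasDerivAt_snd_of_contDiff hF x t).const_mul _

/-- This is the linear equation y' + w^n y = H at each frequency; compact support in time gives zero
data at both ends. -/
theorem waveTransform_dispersiveOp {f : ℝ × ℝ → ℂ} (hf : ContDiff ℝ ∞ f)
    (hc : HasCompactSupport f) (n : ℕ) (l t ξ : ℝ) :
    waveTransform l (dispersiveOp n f) t ξ =
      waveTransform l (planeDeriv (0, 1) f) t ξ + waveSymbol l ξ ^ n * waveTransform l f t ξ := by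
  rw [← waveTransform_iterate hf hc, dispersiveOp_eq hf, waveTransform, waveTransform,
    waveTransform, ← integral_add]
  · congr 1 with x
    simp only [Pi.add_apply]
    ring
  · exact integrable_cexp_mul_fst (hf.planeDeriv _).continuous (hc.planeDeriv _) _ t
  · exact integrable_cexp_mul_fst (contDiff_iterate_planeDeriv hf _ n).continuous
      (hasCompactSupport_iterate_planeDeriv hc _ n) _ t

theorem hasCompactSupport_waveTransform {F : ℝ × ℝ → ℂ} (hF : Continuous F)
    (hc : HasCompactSupport F) (l ξ : ℝ) : HasCompactSupport fun t => waveTransform l F t ξ := by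
  obtain ⟨M, ρ, -, -, -, h⟩ := exists_bound_and_box hF hc
  refine HasCompactSupport.of_support_subset_isCompact (isCompact_Icc (a := -ρ) (b := ρ)) ?_
  intro t ht
  by_contra hcon
  apply ht
  simp only [waveTransform]
  rw [← integral_zero ℝ ℂ]
  congr 1 with x
  have : F (x, t) = 0 := by
    by_contra h0
    exact hcon (abs_le.1 (h x t h0).2)
  rw [this, mul_zero]

theorem continuous_waveTransform_time {F : ℝ × ℝ → ℂ} (hF : ContDiff ℝ ∞ F)
    (hc : HasCompactSupport F) (l ξ : ℝ) : Continuous fun t => waveTransform l F t ξ :=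
  continuous_iff_continuousAt.2 fun t => (hasDerivAt_waveTransform hF hc l t ξ).continuousAt

/-! ### Duhamel's formula with frequency-dependent time direction -/

/-- Duhamel's formula on the Fourier side, solved forwards or backwards in time according to the
sign of the real part of the symbol. -/
theorem integral_propagatorSymbol_mul_waveTransform {f : ℝ × ℝ → ℂ} (hf : ContDiff ℝ ∞ f)
    (hc : HasCompactSupport f) (n : ℕ) (l R t ξ : ℝ) :
    ∫ s : ℝ, propagatorSymbol n l R (t - s) ξ * waveTransform l (dispersiveOp n f) s ξ =
      (Icc (-R) R).indicator (fun ξ => waveTransform l f t ξ) ξ := by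
  by_cases hξ : ξ ∈ Icc (-R) R
  swap
  · rw [indicator_of_notMem hξ, ← integral_zero ℝ ℂ]
    congr 1 with s
    rw [propagatorSymbol, indicator_of_notMem fun h => hξ h.1, zero_mul]
  rw [indicator_of_mem hξ]
  set w : ℂ := waveSymbol l ξ ^ n with hw
  set y : ℝ → ℂ := fun s => waveTransform l f s ξ with hy
  set H : ℝ → ℂ := fun s => waveTransform l (dispersiveOp n f) s ξ with hH
  -- Integrating factor normalized to equal y at s = t; it vanishes for |s| large.
  set G : ℝ → ℂ := fun s => Complex.exp (-((t - s : ℝ) : ℂ) * w) * y s with hG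
  have hHc : Continuous H :=
    continuous_waveTransform_time (contDiff_dispersiveOp hf n) (hasCompactSupport_dispersiveOp hf hc n) l ξ
  have hHs : HasCompactSupport H := hasCompactSupport_waveTransform
    (contDiff_dispersiveOp hf n).continuous (hasCompactSupport_dispersiveOp hf hc n) l ξ
  have hGd : ∀ s, HasDerivAt G (Complex.exp (-((t - s : ℝ) : ℂ) * w) * H s) s := by
    intro s
    have h1 : HasDerivAt (fun s : ℝ => -((t - s : ℝ) : ℂ) * w) w s := by
      have := ((((hasDerivAt_id' s).const_sub t).ofReal_comp).fun_neg).mul_const w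
      simpa using this
    refine (h1.cexp.fun_mul (hasDerivAt_waveTransform hf hc l s ξ)).congr_deriv ?_
    simp only [hH, waveTransform_dispersiveOp hf hc, ← hw]
    ring
  have hint : Integrable fun s : ℝ => Complex.exp (-((t - s : ℝ) : ℂ) * w) * H s := by
    apply Continuous.integrable_of_hasCompactSupport (by fun_prop)
    exact hHs.mul_left
  have hGs : HasCompactSupport G := (hasCompactSupport_waveTransform hf.continuous hc l ξ).mul_left
  have hGcoc : Filter.Tendsto G (Filter.cocompact ℝ) (nhds 0) := hGs.is_zero_at_infty
  have hbot : Filter.Tendsto G Filter.atBot (nhds 0) := hGcoc.mono_left atBot_le_cocompact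
  have htop : Filter.Tendsto G Filter.atTop (nhds 0) := hGcoc.mono_left atTop_le_cocompact
  have hGt : G t = y t := by simp [hG]
  -- The two branches of `decaySet` are complementary, so ξ is active for exactly one sign of t - s.
  -- Integrating G' from -∞, or up to +∞ with a minus sign, matches the sign in the symbol. The
  -- point s = t belongs to the second branch, hence the open half-line in the first case and the
  -- closed one in the second.
  by_cases hre : 0 ≤ w.re
  · have h1 := integral_Iic_of_hasDerivAt_of_tendsto' (a := t) (fun s _ => hGd s) hint.integrableOn hbot
    rw [sub_zero, hGt] at h1
    change _ = y t
    rw [← h1, integral_Iic_eq_integral_Iio, ← integral_indicator measurableSet_Iio]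
    congr 1 with s
    by_cases hs : s < t
    · have hmem : ξ ∈ Icc (-R) R ∩ decaySet n l (t - s) := by
        refine ⟨hξ, ?_⟩
        simp only [decaySet, sub_pos, hs, if_true]
        exact hre
      rw [indicator_of_mem (mem_Iio.2 hs), propagatorSymbol, indicator_of_mem hmem,
        if_pos (sub_pos.2 hs), one_mul]
    · have hmem : ξ ∉ Icc (-R) R ∩ decaySet n l (t - s) := by
        rintro ⟨-, h⟩
        simp only [decaySet, sub_pos, hs, if_false] at h
        exact absurd h (not_lt.2 hre)
      rw [indicator_of_notMem (by simpa using hs), propagatorSymbol, indicator_of_notMem hmem,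
        zero_mul]
  · have hre' : w.re < 0 := not_le.1 hre
    have h1 := integral_Ioi_of_hasDerivAt_of_tendsto' (a := t) (fun s _ => hGd s) hint.integrableOn htop
    rw [zero_sub, hGt] at h1
    have h2 := congrArg Neg.neg h1
    rw [neg_neg] at h2
    change _ = y t
    rw [← h2, ← integral_Ici_eq_integral_Ioi, ← integral_indicator measurableSet_Ici,
      ← integral_neg]
    congr 1 with s
    by_cases hs : s < t
    · have hmem : ξ ∉ Icc (-R) R ∩ decaySet n l (t - s) := by
        rintro ⟨-, h⟩
        simp only [decaySet, sub_pos, hs, if_true] at h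
        exact hre h
      rw [indicator_of_notMem (by simpa using hs), propagatorSymbol, indicator_of_notMem hmem,
        zero_mul, neg_zero]
    · have hmem : ξ ∈ Icc (-R) R ∩ decaySet n l (t - s) := by
        refine ⟨hξ, ?_⟩
        simp only [decaySet, sub_pos, hs, if_false]
        exact hre'
      rw [indicator_of_mem (by simpa using hs), propagatorSymbol, indicator_of_mem hmem,
        if_neg (by simpa using hs)]
      ring

theorem measurable_waveTransform {F : ℝ × ℝ → ℂ} (hF : Continuous F) (l : ℝ) :
    Measurable fun z : ℝ × ℝ => waveTransform l F z.1 z.2 := by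
  have hw := continuous_waveSymbol l
  have h : StronglyMeasurable fun z : (ℝ × ℝ) × ℝ =>
      Complex.exp (-(waveSymbol l z.1.2 * z.2)) * F (z.2, z.1.1) :=
    Continuous.stronglyMeasurable (by fun_prop)
  exact h.integral_prod_right'.measurable

theorem exists_norm_waveTransform_le {F : ℝ × ℝ → ℂ} (hF : Continuous F)
    (hc : HasCompactSupport F) (l : ℝ) :
    ∃ M ρ : ℝ, ∀ s ξ, ‖waveTransform l F s ξ‖ ≤ (Icc (-ρ) ρ).indicator (fun _ => M) s := by
  obtain ⟨M, ρ, hM, hρ, hb, hs⟩ := exists_bound_and_box hF hc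
  refine ⟨∫ x in Icc (-ρ) ρ, Real.exp (l * x) * M, ρ, fun s ξ => ?_⟩
  have hint : IntegrableOn (fun x => Real.exp (l * x) * M) (Icc (-ρ) ρ) :=
    (Continuous.continuousOn (by fun_prop)).integrableOn_Icc
  by_cases h : s ∈ Icc (-ρ) ρ
  · rw [indicator_of_mem h, ← integral_indicator measurableSet_Icc]
    refine norm_integral_le_of_norm_le (hint.integrable_indicator measurableSet_Icc)
      (Filter.Eventually.of_forall fun x => ?_)
    by_cases h0 : F (x, s) = 0
    · rw [h0, mul_zero, norm_zero]
      exact indicator_nonneg (fun x _ => by positivity) x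
    · rw [indicator_of_mem (show x ∈ Icc (-ρ) ρ from abs_le.1 (hs x s h0).1), norm_mul,
        norm_cexp_neg_waveSymbol]
      gcongr
      exact hb _
  · rw [indicator_of_notMem h, waveTransform]
    have h0 : ∀ x, F (x, s) = 0 := fun x => by
      by_contra h0
      exact h (abs_le.1 (hs x s h0).2)
    simp [h0]

theorem measurable_propagatorSymbol_prod (n : ℕ) (l R : ℝ) :
    Measurable fun z : ℝ × ℝ => propagatorSymbol n l R z.1 z.2 := by
  have hw := continuous_waveSymbol l
  have hre : Measurable fun z : ℝ × ℝ => ((waveSymbol l z.2) ^ n).re :=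
    Continuous.measurable (Complex.continuous_re.comp (by fun_prop))
  have hset : MeasurableSet {z : ℝ × ℝ | z.2 ∈ Icc (-R) R ∩ decaySet n l z.1} := by
    have h1 : {z : ℝ × ℝ | z.2 ∈ Icc (-R) R ∩ decaySet n l z.1} =
        (Prod.snd ⁻¹' Icc (-R) R) ∩
        (({z | 0 < z.1} ∩ {z | 0 ≤ ((waveSymbol l z.2) ^ n).re}) ∪
          ({z | 0 < z.1}ᶜ ∩ {z | ((waveSymbol l z.2) ^ n).re < 0})) := by
      ext z
      by_cases h : 0 < z.1 <;> simp [decaySet, h]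
    rw [h1]
    have hp : MeasurableSet {z : ℝ × ℝ | 0 < z.1} := measurableSet_lt measurable_const measurable_fst
    exact (measurable_snd measurableSet_Icc).inter
      ((hp.inter (measurableSet_le measurable_const hre)).union
        (hp.compl.inter (measurableSet_lt hre measurable_const)))
  have h2 : (fun z : ℝ × ℝ => propagatorSymbol n l R z.1 z.2) =
      {z : ℝ × ℝ | z.2 ∈ Icc (-R) R ∩ decaySet n l z.1}.indicator fun z =>
        (if 0 < z.1 then 1 else -1) * Complex.exp (-z.1 * (waveSymbol l z.2) ^ n) := by
    ext z
    rfl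
  rw [h2]
  refine Measurable.indicator ?_ hset
  refine Measurable.mul ?_ (Continuous.measurable (by fun_prop))
  exact Measurable.ite (measurableSet_lt measurable_const measurable_fst) measurable_const
    measurable_const

theorem norm_propagatorSymbol_le_indicator (n : ℕ) (l R τ ξ : ℝ) :
    ‖propagatorSymbol n l R τ ξ‖ ≤ (Icc (-R) R).indicator (fun _ => (1 : ℝ)) ξ := by
  by_cases h : ξ ∈ Icc (-R) R
  · rw [indicator_of_mem h]; exact norm_propagatorSymbol_le n l R τ ξ
  · rw [indicator_of_notMem h, propagatorSymbol, indicator_of_notMem fun h' => h h'.1]; simp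

theorem norm_cexp_two_pi_mul (x ξ : ℝ) :
    ‖Complex.exp (2 * Real.pi * Complex.I * (x * ξ))‖ = 1 := by
  have : (2 * Real.pi * Complex.I * (x * ξ) : ℂ) = ((2 * Real.pi * (x * ξ) : ℝ) : ℂ) * Complex.I := by
    push_cast; ring
  rw [this, Complex.norm_exp_ofReal_mul_I]

theorem propagator_expWeight (n : ℕ) (l R τ : ℝ) (F : ℝ × ℝ → ℂ) (s x : ℝ) :
    propagator n l R τ (fun x => expWeight l F (x, s)) x =
      ∫ ξ : ℝ, Complex.exp (2 * Real.pi * Complex.I * (x * ξ)) *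
        (propagatorSymbol n l R τ ξ * waveTransform l F s ξ) := by
  simp only [propagator, fourierMult, fourier_expWeight]

/-- Fubini and Duhamel at each frequency: the truncated solution is the partial Fourier inversion
integral of the weighted function. -/
theorem integral_propagator_expWeight {f : ℝ × ℝ → ℂ} (hf : ContDiff ℝ ∞ f)
    (hc : HasCompactSupport f) (n : ℕ) (l R t x : ℝ) :
    ∫ s : ℝ, propagator n l R (t - s) (fun x => expWeight l (dispersiveOp n f) (x, s)) x =
      ∫ ξ in Icc (-R) R, Complex.exp (2 * Real.pi * Complex.I * (x * ξ)) *
        𝓕 (fun x => expWeight l f (x, t)) ξ := by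
  have hDc := (contDiff_dispersiveOp hf n).continuous
  have hDs := hasCompactSupport_dispersiveOp hf hc n
  obtain ⟨M, ρ, hM⟩ := exists_norm_waveTransform_le hDc hDs l
  simp_rw [propagator_expWeight]
  rw [integral_integral_swap]
  · rw [← integral_indicator measurableSet_Icc]
    congr 1 with ξ
    rw [integral_const_mul, integral_propagatorSymbol_mul_waveTransform hf hc]
    by_cases h : ξ ∈ Icc (-R) R
    · rw [indicator_of_mem h, indicator_of_mem h, fourier_expWeight]
    · rw [indicator_of_notMem h, indicator_of_notMem h, mul_zero]
  · have hb : Integrable (fun z : ℝ × ℝ => (Icc (-ρ) ρ).indicator (fun _ => M) z.1 *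
        (Icc (-R) R).indicator (fun _ => (1 : ℝ)) z.2) (volume.prod volume) := by
      refine Integrable.mul_prod (f := (Icc (-ρ) ρ).indicator fun _ => M)
        (g := (Icc (-R) R).indicator fun _ => (1 : ℝ)) ?_ ?_ <;>
      exact (integrable_indicator_iff measurableSet_Icc).2 (by simp)
    refine hb.mono' ?_ (Filter.Eventually.of_forall fun z => ?_)
    · have h1 := (measurable_propagatorSymbol_prod n l R).comp
        (show Measurable fun z : ℝ × ℝ => (t - z.1, z.2) by fun_prop)
      have h2 := measurable_waveTransform hDc l
      have h3 : Measurable fun z : ℝ × ℝ => Complex.exp (2 * Real.pi * Complex.I * (x * z.2)) :=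
        Continuous.measurable (by fun_prop)
      exact (h3.mul (h1.mul h2)).aestronglyMeasurable
    · simp only [Function.uncurry]
      rw [norm_mul, norm_mul, norm_cexp_two_pi_mul, one_mul, mul_comm]
      gcongr
      · exact (norm_nonneg _).trans (hM z.1 z.2)
      · exact hM _ _
      · exact norm_propagatorSymbol_le_indicator n l R _ _

theorem contDiff_expWeight {F : ℝ × ℝ → ℂ} (hF : ContDiff ℝ ∞ F) (l : ℝ) :
    ContDiff ℝ ∞ (expWeight l F) := by
  refine ContDiff.mul ?_ hF
  exact Complex.ofRealCLM.contDiff.comp (Real.contDiff_exp.comp (contDiff_const.mul contDiff_fst))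

theorem hasCompactSupport_expWeight {F : ℝ × ℝ → ℂ} (hF : HasCompactSupport F) (l : ℝ) :
    HasCompactSupport (expWeight l F) := hF.mul_left

/-- The truncated solutions converge to the solution as the truncation is removed. -/
theorem tendsto_integral_propagator_expWeight {f : ℝ × ℝ → ℂ} (hf : ContDiff ℝ ∞ f)
    (hc : HasCompactSupport f) (n : ℕ) (l t x : ℝ) :
    Filter.Tendsto (fun R : ℕ => ∫ s : ℝ, propagator n l R (t - s)
      (fun x => expWeight l (dispersiveOp n f) (x, s)) x) Filter.atTop
      (nhds (expWeight l f (x, t))) := by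
  have hg := contDiff_expWeight hf l
  have hgs := hasCompactSupport_expWeight hc l
  have hgt : ContDiff ℝ ∞ fun x => expWeight l f (x, t) := hg.comp (by fun_prop)
  have hgts : HasCompactSupport fun x => expWeight l f (x, t) :=
    hasCompactSupport_fst hg.continuous hgs t
  -- The time slice is a Schwartz function, so its transform is integrable and Fourier inversion
  -- holds at every point.
  have hFi : Integrable (𝓕 fun x => expWeight l f (x, t)) := by
    have := (𝓕 (hgts.toSchwartzMap hgt)).integrable (μ := volume)
    rwa [SchwartzMap.fourier_coe] at this
  have hinv := congrFun (hgt.continuous.fourierInv_fourier_eq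
    (hgt.continuous.integrable_of_hasCompactSupport hgts) hFi) x
  rw [fourierInv_real_eq] at hinv
  rw [← hinv]
  simp_rw [integral_propagator_expWeight hf hc]
  have hcov : AECover (volume : Measure ℝ) Filter.atTop fun R : ℕ => Icc (-(R : ℝ)) R :=
    aecover_Icc (Filter.tendsto_neg_atTop_atBot.comp tendsto_natCast_atTop_atTop)
      tendsto_natCast_atTop_atTop
  exact hcov.integral_tendsto_of_countably_generated (integrable_cexp_mul hFi x)

theorem measurable_propagator_expWeight {F : ℝ × ℝ → ℂ} (hF : Continuous F) (n : ℕ) (l R t : ℝ) :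
    Measurable (Function.uncurry fun x s : ℝ =>
      propagator n l R (t - s) (fun x => expWeight l F (x, s)) x) := by
  simp_rw [propagator_expWeight]
  have h1 := (measurable_propagatorSymbol_prod n l R).comp
    (show Measurable fun z : (ℝ × ℝ) × ℝ => (t - z.1.2, z.2) by fun_prop)
  have h2 := (measurable_waveTransform hF l).comp
    (show Measurable fun z : (ℝ × ℝ) × ℝ => (z.1.2, z.2) by fun_prop)
  have h3 : Measurable fun z : (ℝ × ℝ) × ℝ =>
      Complex.exp (2 * Real.pi * Complex.I * (z.1.1 * z.2)) :=
    Continuous.measurable (by fun_prop)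
  exact (h3.mul (h1.mul h2)).stronglyMeasurable.integral_prod_right'.measurable

/-! ### Minkowski in time and removal of the truncation -/

/-- A set of full measure is dense and the inequality is a closed condition. The pointwise form is
what Minkowski at p = ∞ needs, since the exceptional null sets could vary with s. -/
theorem enorm_le_eLpNorm_top_of_continuous {f : ℝ → ℂ} (hf : Continuous f) (x : ℝ) :
    ‖f x‖ₑ ≤ eLpNorm f ⊤ volume := by
  have h1 : ∀ᵐ x, ‖f x‖ₑ ≤ eLpNorm f ⊤ volume := by
    rw [eLpNorm_exponent_top]
    exact ae_le_eLpNormEssSup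
  have hd := Measure.dense_of_ae h1
  have hcl : IsClosed {x | ‖f x‖ₑ ≤ eLpNorm f ⊤ volume} := isClosed_le hf.enorm continuous_const
  exact hcl.closure_subset (hd x)

theorem eLpNorm_integral_le {F : ℝ → ℝ → ℂ} (hF : Measurable (Function.uncurry F))
    (hFc : ∀ s, Continuous fun x => F x s) {p : ℝ≥0∞} (hp : 2 ≤ p) :
    eLpNorm (fun x => ∫ s, F x s) p volume ≤ ∫⁻ s, eLpNorm (fun x => F x s) p volume := by
  by_cases hpt : p = ⊤
  · subst hpt
    rw [eLpNorm_exponent_top]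
    refine essSup_le_of_ae_le _ (Filter.Eventually.of_forall fun x => ?_)
    refine (enorm_integral_le_lintegral_enorm _).trans (lintegral_mono fun s => ?_)
    exact enorm_le_eLpNorm_top_of_continuous (hFc s) x
  · have hp0 : p ≠ 0 := (lt_of_lt_of_le (by norm_num) hp).ne'
    have hp1 : 1 < p.toReal := by
      have := (ENNReal.toReal_le_toReal (by norm_num) hpt).2 hp
      have h2 : (2 : ℝ≥0∞).toReal = 2 := by simp
      linarith
    simp_rw [eLpNorm_eq_lintegral_rpow_enorm_toReal hp0 hpt]
    refine le_trans ?_ (lintegral_lintegral_rpow_le (F := fun x s => ‖F x s‖ₑ)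
      (μ := volume) (ν := volume) hF.enorm hp1)
    gcongr with x
    exact enorm_integral_le_lintegral_enorm _

/-- The pointwise-in-time consequence of the dispersive estimate and Duhamel's formula. -/
theorem exists_eLpNorm_expWeight_le {n : ℕ} (hn : 2 ≤ n) {p p' : ℝ≥0∞} (hp : 2 ≤ p)
    (hpp' : 1 / p + 1 / p' = 1) :
    ∃ C : ℝ≥0, ∀ (l : ℝ) (f : ℝ × ℝ → ℂ), ContDiff ℝ ∞ f → HasCompactSupport f → ∀ t : ℝ,
      eLpNorm (fun x => expWeight l f (x, t)) p volume ≤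
        C * ∫⁻ s, rieszKernel ((1 - 2 * (p⁻¹).toReal) / n) (t - s) *
          eLpNorm (fun x => expWeight l (dispersiveOp n f) (x, s)) p' volume := by
  obtain ⟨C, hC⟩ := exists_eLpNorm_propagator_le hn hp hpp'
  refine ⟨C, fun l f hf hc t => ?_⟩
  have hD := contDiff_dispersiveOp hf n
  have hDs := hasCompactSupport_dispersiveOp hf hc n
  have hh := (contDiff_expWeight hD l).continuous
  have hhs := hasCompactSupport_expWeight hDs l
  have hsc : ∀ s, Continuous fun x => expWeight l (dispersiveOp n f) (x, s) := fun s => by fun_prop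
  have hss : ∀ s, HasCompactSupport fun x => expWeight l (dispersiveOp n f) (x, s) :=
    fun s => hasCompactSupport_fst hh hhs s
  have hm := fun R : ℝ => measurable_propagator_expWeight hD.continuous n l R t
  have hcont : ∀ R s : ℝ, Continuous fun x =>
      propagator n l R (t - s) (fun x => expWeight l (dispersiveOp n f) (x, s)) x := fun R s =>
    continuous_fourierMult (integrable_propagatorSymbol n l R (t - s))
      ((hsc s).integrable_of_hasCompactSupport (hss s))
  -- Fatou: a bound uniform in R passes to the pointwise limit.
  refine Lp.eLpNorm_le_of_ae_tendsto (u := Filter.atTop) (f := fun (R : ℕ) x =>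
    ∫ s : ℝ, propagator n l R (t - s) (fun x => expWeight l (dispersiveOp n f) (x, s)) x)
    (Filter.Eventually.of_forall fun R => ?_)
    (fun R => ((hm R).stronglyMeasurable.integral_prod_right').aestronglyMeasurable)
    (Filter.Eventually.of_forall fun x => tendsto_integral_propagator_expWeight hf hc n l t x)
  refine (eLpNorm_integral_le (hm R) (hcont R) hp).trans ?_
  rw [← lintegral_const_mul' _ _ (by simp)]
  refine lintegral_mono_ae ?_
  -- The propagator bound excludes time difference zero, a null set of s.
  have hne : ∀ᵐ s : ℝ, s ≠ t := by
    simp [ae_iff, measure_singleton]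
  filter_upwards [hne] with s hs
  exact hC l R (t - s) (Nat.cast_nonneg R) (sub_ne_zero.2 hs.symm) _ (hsc s).measurable
    ((hsc s).memLp_of_hasCompactSupport (hss s)) ((hsc s).memLp_of_hasCompactSupport (hss s))

theorem measurable_eLpNorm_fst {F : ℝ × ℝ → ℂ} (hF : Continuous F) {p : ℝ≥0∞} (hp0 : p ≠ 0)
    (hpt : p ≠ ⊤) : Measurable fun s => eLpNorm (fun x => F (x, s)) p volume := by
  simp_rw [eLpNorm_eq_lintegral_rpow_enorm_toReal hp0 hpt]
  refine Measurable.pow_const ?_ _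
  refine Measurable.lintegral_prod_right' (f := fun z : ℝ × ℝ => ‖F (z.2, z.1)‖ₑ ^ p.toReal) ?_
  exact (Continuous.measurable (by fun_prop)).pow_const _

theorem conj_ne_zero_ne_top {p p' : ℝ≥0∞} (hp : 2 ≤ p) (hpp' : 1 / p + 1 / p' = 1) :
    p' ≠ 0 ∧ p' ≠ ⊤ := by
  constructor
  · rintro rfl
    simp at hpp'
  · rintro rfl
    simp only [one_div, ENNReal.inv_top, add_zero] at hpp'
    have h1 : p = 1 := by rw [← inv_inv p, hpp', inv_one]
    rw [h1] at hp
    norm_num at hp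

/-! ### Conclusion -/

theorem lemma4p1 (j : ℕ) (hj : 1 ≤ j) (p q p' q' : ℝ≥0∞) (hp : 2 ≤ p)
    (hpq : 1 / (2 * (j : ℝ≥0∞) + 1) = 2 / q + 2 / ((2 * (j : ℝ≥0∞) + 1) * p))
    (hpp' : 1 / p + 1 / p' = 1) (hqq' : 1 / q + 1 / q' = 1) :
    ∃ c : ℝ≥0, ∀ (l : ℝ) (f : ℝ × ℝ → ℂ), ContDiff ℝ ∞ f → HasCompactSupport f →
      mixedNorm q p (expWeight l f) ≤
        c * mixedNorm q' p' (expWeight l (dispersiveOp (2 * j + 1) f)) := by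
  set n : ℕ := 2 * j + 1 with hn
  have hnE : 2 * (j : ℝ≥0∞) + 1 = (n : ℝ≥0∞) := by rw [hn]; push_cast; rfl
  rw [hnE] at hpq
  have hn0 : (n : ℝ) ≠ 0 := by rw [hn]; positivity
  have hn3 : (3 : ℝ) ≤ n := by rw [hn]; exact_mod_cast (by omega : 3 ≤ 2 * j + 1)
  have hnE0 : (n : ℝ≥0∞) ≠ 0 := by exact_mod_cast (by omega : n ≠ 0)
  have hp0 : p ≠ 0 := (lt_of_lt_of_le (by norm_num) hp).ne'
  have hq0 : q ≠ 0 := by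
    rintro rfl
    rw [ENNReal.div_zero (by norm_num), top_add] at hpq
    exact ENNReal.div_ne_top (by simp) hnE0 hpq
  -- The relation between p and q equates the dispersive decay exponent with the kernel exponent 2/q
  -- of Hardy–Littlewood–Sobolev.
  have hreal : (1 - 2 * (p⁻¹).toReal) / n = 2 * (q⁻¹).toReal := by
    have h1 := congrArg ENNReal.toReal hpq
    rw [ENNReal.toReal_add (ENNReal.div_ne_top (by simp) hq0)
      (ENNReal.div_ne_top (by simp) (mul_ne_zero hnE0 hp0))] at h1
    simp only [ENNReal.toReal_div, ENNReal.toReal_mul, ENNReal.toReal_natCast,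
      ENNReal.toReal_one, ENNReal.toReal_ofNat] at h1
    rw [ENNReal.toReal_inv, ENNReal.toReal_inv]
    rw [div_eq_mul_inv 2 q.toReal, div_mul_eq_div_mul_one_div, one_div p.toReal] at h1
    rw [← sub_eq_iff_eq_add] at h1
    rw [← h1]
    ring
  obtain ⟨C, hC⟩ := exists_eLpNorm_expWeight_le (n := n) (by omega) hp hpp'
  rw [hreal] at hC
  obtain ⟨hp'0, hp't⟩ := conj_ne_zero_ne_top hp hpp'
  -- Here the kernel exponent is 0, the kernel is identically 1, and q' = 1: the bound at each t
  -- already suffices.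
  by_cases hqt : q = ⊤
  · subst hqt
    have hq'1 : q' = 1 := by simpa using hqq'
    subst hq'1
    refine ⟨C, fun l f hf hc => ?_⟩
    unfold mixedNorm
    rw [eLpNorm_exponent_top, eLpNorm_one_eq_lintegral_enorm]
    refine essSup_le_of_ae_le _ (Filter.Eventually.of_forall fun t => ?_)
    refine (hC l f hf hc t).trans (le_of_eq ?_)
    simp [rieszKernel]
  · have hqr : 0 < q.toReal := ENNReal.toReal_pos hq0 hqt
    -- Indeed 2/q = (1 - 2/p)/n ≤ 1/n < 1, so the kernel is locally integrable.
    have hq2 : 2 < q.toReal := by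
      have h1 : 2 * (q⁻¹).toReal < 1 := by
        rw [← hreal, div_lt_one (by linarith)]
        have : 0 ≤ (p⁻¹).toReal := ENNReal.toReal_nonneg
        linarith
      rw [ENNReal.toReal_inv, ← div_eq_mul_inv, div_lt_one hqr] at h1
      exact h1
    have hqE : 2 < q := by
      rw [← ENNReal.toReal_lt_toReal (by norm_num) hqt]
      simpa using hq2
    have hq' := exists_conj_toReal hqE hqt hqq'
    obtain ⟨K, hK⟩ := exists_rieszKernel_conv_Lp_le hq2
    refine ⟨C * K, fun l f hf hc => ?_⟩
    have hφ : Measurable fun s => eLpNorm (fun x => expWeight l (dispersiveOp n f) (x, s)) p' volume :=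
      measurable_eLpNorm_fst (contDiff_expWeight (contDiff_dispersiveOp hf n) l).continuous hp'0 hp't
    have hq'0 : 0 < q.toReal / (q.toReal - 1) := div_pos hqr (by linarith)
    have hKφ := hK _ hφ
    rw [ENNReal.toReal_inv, ← div_eq_mul_inv] at hC
    unfold mixedNorm
    rw [hq', eLpNorm_eq_lintegral_rpow_enorm_toReal hq0 hqt,
      eLpNorm_eq_lintegral_rpow_enorm_toReal (by simpa using hq'0) (by simp),
      ENNReal.toReal_ofReal hq'0.le]
    simp only [enorm_eq_self]
    calc _ ≤ (∫⁻ t, (C * ∫⁻ s, rieszKernel (2 / q.toReal) (t - s) *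
          eLpNorm (fun x => expWeight l (dispersiveOp n f) (x, s)) p' volume) ^ q.toReal) ^
            (1 / q.toReal) := by
          gcongr with t
          exact hC l f hf hc t
      _ = C * (∫⁻ t, (∫⁻ s, rieszKernel (2 / q.toReal) (t - s) *
          eLpNorm (fun x => expWeight l (dispersiveOp n f) (x, s)) p' volume) ^ q.toReal) ^
            (1 / q.toReal) := by
          simp_rw [ENNReal.mul_rpow_of_nonneg _ _ hqr.le]
          rw [lintegral_const_mul' _ _ (ENNReal.rpow_ne_top_of_nonneg hqr.le (by simp)),
            ENNReal.mul_rpow_of_nonneg _ _ (by positivity), ← ENNReal.rpow_mul,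
            mul_one_div_cancel hqr.ne', ENNReal.rpow_one]
      _ ≤ C * (K * _) := by gcongr
      _ = _ := by rw [ENNReal.coe_mul, mul_assoc]
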